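/- Equip $\mathbb R^5$ with the Lorentzian product $\langle v,w\rangle=-v_0w_0+v_1w_1+v_2w_2+v_3w_3+v_4w_4$, and let $\mathbb H^4=\{x\in\mathbb R^5 : \langle x,x\rangle=-1,\ x_0>0\}$. A space-like vector $v$ determines the half-space $\{x\in\mathbb H^4:\langle v,x\rangle\le 0\}$. For $t\in(0,1]$ consider the 24 vectors $$i^+=\Big(\sqrt2,a,b,c,\frac{abc}{t}\Big),\qquad i^-=\big(\sqrt2,a,b,c,-abc\,t\big),\qquad (a,b,c)\in\{1,-1\}^3,$$ (so that there are 8 vectors of each of these two types), together with the six vectors $A,\dots,F$ of the form $(1,\pm\sqrt2,0,0,0)$, $(1,0,\pm\sqrt2,0,0)$, $(1,0,0,\pm\sqrt2,0)$, and the two vectors $G,H=(1,0,0,0,\mp\sqrt2\,t)$. Let $P_t\subset\mathbb H^4$ be the intersection of the half-spaces determined by all 24 vectors if $t>\sqrt{1/2}$, and by the 22 vectors other than $G,H$ if $t\le\sqrt{1/2}$. Put $t_1=\sqrt{3/5}$ and $\bar t=\sqrt{1/3}$. For a polytope $P\subset\mathbb H^4$ (an intersection of finitely many half-spaces with non-empty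 interior), the strata of $P$ are $P$ itself and its walls, two-dimensional faces, edges and finite vertices (ideal vertices are excluded). $P$ is a Coxeter polytope if each of its dihedral angles is $\pi/n$ for some integer $n\ge2$. In that case its orbifold Euler characteristic is $$\chi(P)=\sum_s\frac{(-1)^{\dim s}}{|\mathrm{Stab}(s)|},$$ where the sum is over all strata $s$ of $P$, and $\mathrm{Stab}(s)$ is the stabilizer of $s$ in the group generated by the reflections along the walls of $P$. Then the following hold. (1) $P_{t_1}$ is a Coxeter polytope. Besides $P_{t_1}$ itself (trivial stabilizer), its strata are exactly: 24 walls, with stabilizer of order 2; 100 two-dimensional faces, of which 88 have stabilizer of order 4 and 12 of order 6; 120 edges, of which 72 have stabilizer of order 8 and 48 of order 12; and 24 finite vertices, with stabilizer of order 24. Moreover $\chi(P_{t_1})=1$. (2) $P_{\bar t}$ is a Coxeter polytope. Besides $P_{\bar t}$ itself (trivial stabilizer), its strata are exactly: 22 walls, with stabilizer of order 2; 92 two-dimensional faces, with stabilizer of order 4; 116 edges, with stabilizer of order 8; and 34 finite vertices, with stabilizer of order 16. Moreover $\chi(P_{\bar t})=\frac58$. -/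

import Mathlib

open scoped Pointwise

namespace HypFour

/-- The ambient space `ℝ⁵` with coordinates `x₀, …, x₄`. -/
abbrev V : Type := Fin 5 → ℝ

/-- The Lorentzian product `-x₀y₀ + x₁y₁ + x₂y₂ + x₃y₃ + x₄y₄`. -/
def lor (x y : V) : ℝ :=
  -(x 0 * y 0) + x 1 * y 1 + x 2 * y 2 + x 3 * y 3 + x 4 * y 4

/-- Hyperbolic four-space: the upper sheet of the hyperboloid `⟨x, x⟩ = -1`. -/
def hyp : Set V := {x | lor x x = -1 ∧ 0 < x 0}

/-- The half-space of hyperbolic space determined by a (space-like) vector `v`. -/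
def halfSpace (v : V) : Set V := {x | x ∈ hyp ∧ lor v x ≤ 0}

/-- The hyperplane of hyperbolic space determined by a (space-like) vector `v`. -/
def hyperplane (v : V) : Set V := {x | x ∈ hyp ∧ lor v x = 0}

/-- The intersection of the half-spaces determined by the vectors of `S`. -/
def poly (S : Set V) : Set V := {x | x ∈ hyp ∧ ∀ v ∈ S, x ∈ halfSpace v}

/-- `S` is a finite set of space-like vectors, and the intersection of the half-spaces that
they determine has non-empty interior in hyperbolic space, i.e. it is a polytope. -/
def IsPolytope (S : Set V) : Prop :=
  S.Finite ∧ (∀ v ∈ S, 0 < lor v v) ∧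
    (interior {x : hyp | (x : V) ∈ poly S}).Nonempty

/-- Dimension of a non-empty convex subset of hyperbolic space: the dimension of the smallest
totally geodesic subspace that contains it, which is cut out by the linear span. -/
noncomputable def hdim (s : Set V) : ℕ := Module.finrank ℝ (Submodule.span ℝ s) - 1

/-- The (closed) strata of the polytope: the polytope itself and the non-empty intersections of
the polytope with bounding hyperplanes. Ideal vertices are not in `hyp` and do not occur. -/
def strata (S : Set V) : Set (Set V) :=
  {s | s.Nonempty ∧ ∃ I : Set V, I ⊆ S ∧ s = {x | x ∈ poly S ∧ ∀ v ∈ I, x ∈ hyperplane v}}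

/-- The vectors of `S` whose hyperplane meets the polytope in a wall, that is, in a stratum of
dimension three. -/
def wallVectors (S : Set V) : Set V :=
  {v | v ∈ S ∧ (poly S ∩ hyperplane v).Nonempty ∧ hdim (poly S ∩ hyperplane v) = 3}

/-- The dihedral angle `θ`, with `cos θ = -⟨v, w⟩ / √(⟨v, v⟩ ⟨w, w⟩)`, of the intersection of the
half-spaces of `v` and `w`, when their bounding hyperplanes intersect. -/
noncomputable def dihedralAngle (v w : V) : ℝ :=
  Real.arccos (-(lor v w) / Real.sqrt (lor v v * lor w w))

/-- A Coxeter polytope: at every two-dimensional stratum, the dihedral angle of the two walls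
that meet there is `π / n` for some integer `n ≥ 2`. -/
def IsCoxeterPolytope (S : Set V) : Prop :=
  IsPolytope S ∧
    ∀ v ∈ wallVectors S, ∀ w ∈ wallVectors S,
      (poly S ∩ hyperplane v ∩ hyperplane w).Nonempty →
      hdim (poly S ∩ hyperplane v ∩ hyperplane w) = 2 →
      ∃ n : ℕ, 2 ≤ n ∧ dihedralAngle v w = Real.pi / n

/-- The linear map `x ↦ x - 2 (⟨v, x⟩ / ⟨v, v⟩) v`. -/
noncomputable def reflMap (v : V) : V →ₗ[ℝ] V where
  toFun x := x - (2 * (lor v x / lor v v)) • v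
  map_add' x y := by
    ext i
    simp only [lor, Pi.add_apply, Pi.sub_apply, Pi.smul_apply, smul_eq_mul]
    ring
  map_smul' c x := by
    ext i
    simp only [lor, Pi.sub_apply, Pi.smul_apply, smul_eq_mul, RingHom.id_apply]
    ring

theorem reflMap_apply (v x : V) : reflMap v x = x - (2 * (lor v x / lor v v)) • v := rfl

theorem lor_sub_smul (v x : V) (c : ℝ) : lor v (x - c • v) = lor v x - c * lor v v := by
  simp only [lor, Pi.sub_apply, Pi.smul_apply, smul_eq_mul]
  ring

theorem reflMap_involutive (v : V) : Function.Involutive (reflMap v) := by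
  intro x
  by_cases h : lor v v = 0
  · simp [reflMap_apply, h]
  · rw [reflMap_apply v (reflMap v x), reflMap_apply v x, lor_sub_smul, sub_sub, ← add_smul]
    have : 2 * (lor v x / lor v v) +
        2 * ((lor v x - 2 * (lor v x / lor v v) * lor v v) / lor v v) = 0 := by
      field_simp
      ring
    rw [this, zero_smul, sub_zero]

/-- The reflection in the hyperplane orthogonal to the space-like vector `v`. -/
noncomputable def refl (v : V) : V ≃ₗ[ℝ] V :=
  LinearEquiv.ofInvolutive (reflMap v) (reflMap_involutive v)

/-- The group generated by the reflections along the walls of the polytope. The isometries of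
hyperbolic space are represented by the linear maps of `ℝ⁵` that restrict to them. -/
noncomputable def reflGroup (S : Set V) : Subgroup (V ≃ₗ[ℝ] V) :=
  Subgroup.closure (refl '' wallVectors S)

/-- The stabilizer `{g ∈ Γ | g(s) = s}` of a stratum `s` in the reflection group `Γ`. -/
noncomputable def stab (S : Set V) (s : Set V) : Subgroup (reflGroup S) :=
  MulAction.stabilizer (reflGroup S) s

/-- The orbifold Euler characteristic `∑ₛ (-1) ^ dim s / |Stab s|`, over all the strata `s`. -/
noncomputable def eulerChar (S : Set V) : ℚ :=
  ∑ᶠ s ∈ strata S, (-1 : ℚ) ^ hdim s / (Nat.card (stab S s) : ℚ)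

/-- The number of strata of dimension `k` with stabilizer of order `n`. -/
noncomputable def stratumCount (S : Set V) (k n : ℕ) : ℕ :=
  {s | s ∈ strata S ∧ hdim s = k ∧ Nat.card (stab S s) = n}.ncard

/-- The positive vectors `0⁺, …, 7⁺`. -/
noncomputable def posVec (t : ℝ) : Fin 8 → V :=
  ![![√2, 1, 1, 1, 1 / t],
    ![√2, 1, -1, 1, -1 / t],
    ![√2, 1, -1, -1, 1 / t],
    ![√2, 1, 1, -1, -1 / t],
    ![√2, -1, 1, -1, 1 / t],
    ![√2, -1, 1, 1, -1 / t],
    ![√2, -1, -1, 1, 1 / t],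
    ![√2, -1, -1, -1, -1 / t]]

/-- The negative vectors `0⁻, …, 7⁻`. -/
noncomputable def negVec (t : ℝ) : Fin 8 → V :=
  ![![√2, 1, 1, 1, -t],
    ![√2, 1, -1, 1, t],
    ![√2, 1, -1, -1, -t],
    ![√2, 1, 1, -1, t],
    ![√2, -1, 1, -1, -t],
    ![√2, -1, 1, 1, t],
    ![√2, -1, -1, 1, -t],
    ![√2, -1, -1, -1, t]]

/-- The letter vectors `A, …, F`. -/
noncomputable def letterVec : Fin 6 → V :=
  ![![1, √2, 0, 0, 0],
    ![1, 0, √2, 0, 0],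
    ![1, 0, 0, √2, 0],
    ![1, 0, 0, -√2, 0],
    ![1, 0, -√2, 0, 0],
    ![1, -√2, 0, 0, 0]]

/-- The letter vectors `G` and `H`. -/
noncomputable def extraVec (t : ℝ) : Fin 2 → V :=
  ![![1, 0, 0, 0, -√2 * t],
    ![1, 0, 0, 0, √2 * t]]

/-- The vectors that define `P_t`: all `24` vectors if `t > √(1/2)`, and the `22` vectors other
than `G` and `H` if `t ≤ √(1/2)`. -/
noncomputable def P (t : ℝ) : Set V :=
  Set.range (posVec t) ∪ Set.range (negVec t) ∪ Set.range letterVec ∪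
    {v | √(1 / 2) < t ∧ v ∈ Set.range (extraVec t)}

end HypFour

open HypFour

/-!
The vectors that bound `P_t` have, for `t² = 3 / 5` and for `t² = 1 / 3`, a very restricted Gram
matrix: any two distinct ones are orthogonal, or have equal norm and bound half-spaces at the angle
`π / 3` (`Third`), or have hyperplanes that do not meet in hyperbolic space (`Apart`). Everything in
the theorem follows from this (`IsAcute`), and the faces of the polytope need not be computed in
coordinates.

*Faces.* The Lorentzian product is positive definite on the orthogonal complement of a point of
hyperbolic space. So the walls through such a point contain no two that are apart
(`not_apart_of_lor_eq_zero`), and no three with pairwise angles `π / 3` (`not_third_triangle`). For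
the two Gram matrices at hand, this leaves only sets of pairwise orthogonal walls, with at most one
exceptional pair at angle `π / 3` (`IsElliptic`). Conversely, each such set `J` is the exact set of
walls through some point of the polytope: all products of distinct vectors being non-positive, the
orthogonal projection of the base point to the complement of `J` stays strictly inside the other
half-spaces (`IsElliptic.exists_timelike`). The stratum of `J` spans the orthogonal complement of
`J`, hence has dimension `4 - |J|`.

*Stabilizers.* Tits's argument on word length shows that an element of the reflection group which is
not shortened by the reflection along `v` sends `v` to a positive root
(`isPositive_of_wordLength_le`). Hence the polytope is a strict fundamental domain, and an element
that maps a point of the polytope into the polytope is a product of reflections in walls through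
that point (`mem_reflClosure_of_map_mem_poly`). So the stabilizer of the stratum of `J` is generated
by the reflections along `J`; its order is `2 ^ |J|`, or `6 * 2 ^ (|J| - 2)` if there is an
exceptional pair.

*Counting.* After rescaling the vectors, and absorbing `√2` and `t` in the coordinates, the Gram
matrices become integral. It remains to enumerate the elliptic subsets of a graph with `24` or `22`
vertices, which is a computation (`Wall.IsDiagram`, `Wall.cliques`).
-/

namespace HypFour

/-! ### The Lorentzian product and reflections -/

theorem lor_comm (x y : V) : lor x y = lor y x := by
  simp only [lor]; ring

theorem lor_add_right (x y z : V) : lor x (y + z) = lor x y + lor x z := by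
  simp only [lor, Pi.add_apply]; ring

theorem lor_add_left (x y z : V) : lor (x + y) z = lor x z + lor y z := by
  simp only [lor, Pi.add_apply]; ring

theorem lor_sub_right (x y z : V) : lor x (y - z) = lor x y - lor x z := by
  simp only [lor, Pi.sub_apply]; ring

theorem lor_sub_left (x y z : V) : lor (x - y) z = lor x z - lor y z := by
  simp only [lor, Pi.sub_apply]; ring

theorem lor_smul_right (c : ℝ) (x y : V) : lor x (c • y) = c * lor x y := by
  simp only [lor, Pi.smul_apply, smul_eq_mul]; ring

theorem lor_smul_left (c : ℝ) (x y : V) : lor (c • x) y = c * lor x y := by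
  simp only [lor, Pi.smul_apply, smul_eq_mul]; ring

theorem lor_neg_left (x y : V) : lor (-x) y = -lor x y := by
  simp only [lor, Pi.neg_apply]; ring

theorem refl_apply (v x : V) : refl v x = x - (2 * (lor v x / lor v v)) • v := rfl

theorem refl_refl (v x : V) : refl v (refl v x) = x := reflMap_involutive v x

theorem refl_mul_self (v : V) : refl v * refl v = 1 :=
  LinearEquiv.ext fun x => refl_refl v x

theorem mul_refl_mul_refl (g : V ≃ₗ[ℝ] V) (v : V) : g * refl v * refl v = g := by
  rw [mul_assoc, refl_mul_self, mul_one]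

theorem inv_refl (v : V) : (refl v)⁻¹ = refl v :=
  inv_eq_of_mul_eq_one_left (refl_mul_self v)

theorem refl_self {v : V} (hv : lor v v ≠ 0) : refl v v = -v := by
  rw [refl_apply, div_self hv, mul_one, two_smul]
  abel

theorem refl_of_lor_eq_zero {v x : V} (h : lor v x = 0) : refl v x = x := by
  rw [refl_apply, h]; simp

theorem lor_refl_refl (v x y : V) : lor (refl v x) (refl v y) = lor x y := by
  by_cases hv : lor v v = 0
  · simp [refl_apply, hv]
  · simp only [refl_apply, lor_sub_left, lor_sub_right, lor_smul_left, lor_smul_right,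
      lor_comm x v]
    field_simp
    ring

theorem refl_mul_refl_comm {v w : V} (h : lor v w = 0) : refl v * refl w = refl w * refl v := by
  have h' : lor w v = 0 := by rw [lor_comm, h]
  ext1 x
  simp only [LinearEquiv.mul_apply, refl_apply, lor_sub_right, lor_smul_right, h, h', mul_zero,
    sub_zero]
  abel

/-! ### Pairs of half-spaces -/

/-- The half-spaces of the space-like vectors `v` and `w`, of equal norm, have bounding
hyperplanes that meet at the angle `π / 3`. -/
def Third (v w : V) : Prop := lor v v = lor w w ∧ 2 * lor v w = -lor v v

/-- The bounding hyperplanes of the space-like vectors `v` and `w` do not meet in hyperbolic space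
(they are parallel or ultraparallel), and their half-spaces face each other. -/
def Apart (v w : V) : Prop := lor v w < 0 ∧ lor v v * lor w w ≤ lor v w ^ 2

theorem Third.symm {v w : V} (h : Third v w) : Third w v := by
  refine ⟨h.1.symm, ?_⟩
  rw [lor_comm w v, h.2, h.1]

theorem Apart.symm {v w : V} (h : Apart v w) : Apart w v := by
  refine ⟨by rw [lor_comm]; exact h.1, ?_⟩
  rw [lor_comm w v, mul_comm]; exact h.2

theorem Third.refl_apply {v w : V} (h : Third v w) (hv : lor v v ≠ 0) : refl v w = v + w := by
  have : 2 * (lor v w / lor v v) = -1 := by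
    rw [← mul_div_assoc, h.2, neg_div, div_self hv]
  rw [HypFour.refl_apply, this]
  module

theorem Third.braid {v w : V} (h : Third v w) (hv : lor v v ≠ 0) :
    refl v * refl w * refl v = refl w * refl v * refl w := by
  obtain ⟨h1, h2⟩ := h
  have h3 : lor v w = -lor v v / 2 := by linarith
  ext1 x
  simp only [LinearEquiv.mul_apply, HypFour.refl_apply, lor_sub_right, lor_smul_right,
    lor_comm w v, ← h1, h3]
  match_scalars <;> field_simp <;> ring

/-- A finite set of space-like vectors in which any two distinct vectors are orthogonal, at angle
`π / 3`, or apart. The condition `0 < v 0` says that the base point `(1, 0, 0, 0, 0)` lies in the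
interior of every half-space. -/
structure IsAcute (S : Set V) : Prop where
  finite : S.Finite
  pos : ∀ v ∈ S, 0 < lor v v
  time : ∀ v ∈ S, 0 < v 0
  pair : ∀ v ∈ S, ∀ w ∈ S, v ≠ w → lor v w = 0 ∨ Third v w ∨ Apart v w

theorem IsAcute.lor_nonpos {S : Set V} (hS : IsAcute S) {v w : V} (hv : v ∈ S) (hw : w ∈ S)
    (h : v ≠ w) : lor v w ≤ 0 := by
  rcases hS.pair v hv w hw h with h | h | h
  · exact h.le
  · have := h.2
    have := hS.pos v hv
    linarith
  · exact h.1.le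

/-! ### Word length in the reflection group -/

/-- The group generated by the reflections along the vectors of `S`. -/
noncomputable def reflClosure (S : Set V) : Subgroup (V ≃ₗ[ℝ] V) := Subgroup.closure (refl '' S)

theorem refl_mem_reflClosure {S : Set V} {v : V} (hv : v ∈ S) : refl v ∈ reflClosure S :=
  Subgroup.subset_closure ⟨v, hv, rfl⟩

theorem reflClosure_mono {S T : Set V} (h : S ⊆ T) : reflClosure S ≤ reflClosure T :=
  Subgroup.closure_mono (Set.image_mono h)

/-- The length of the shortest word in the reflections along `S` that represents `g`; it has the
junk value `0` if there is no such word. -/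
noncomputable def wordLength (S : Set V) (g : V ≃ₗ[ℝ] V) : ℕ :=
  sInf {n | ∃ l : List V, (∀ v ∈ l, v ∈ S) ∧ (l.map refl).prod = g ∧ l.length = n}

theorem exists_word {S : Set V} {g : V ≃ₗ[ℝ] V} (hg : g ∈ reflClosure S) :
    ∃ l : List V, (∀ v ∈ l, v ∈ S) ∧ (l.map refl).prod = g := by
  induction hg using Subgroup.closure_induction with
  | mem x hx =>
    obtain ⟨v, hv, rfl⟩ := hx
    exact ⟨[v], by simpa using hv, by simp⟩
  | one => exact ⟨[], by simp, by simp⟩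
  | mul x y _ _ hx hy =>
    obtain ⟨l, hl, rfl⟩ := hx
    obtain ⟨m, hm, rfl⟩ := hy
    exact ⟨l ++ m, by simpa [or_imp, forall_and] using ⟨hl, hm⟩, by simp⟩
  | inv x _ hx =>
    obtain ⟨l, hl, rfl⟩ := hx
    refine ⟨l.reverse, by simpa using hl, ?_⟩
    rw [List.prod_inv_reverse, List.map_map, List.map_reverse]
    congr 2

theorem exists_shortest_word {S : Set V} {g : V ≃ₗ[ℝ] V} (hg : g ∈ reflClosure S) :
    ∃ l : List V, (∀ v ∈ l, v ∈ S) ∧ (l.map refl).prod = g ∧ l.length = wordLength S g := by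
  obtain ⟨l, hl, hl'⟩ := exists_word hg
  exact Nat.sInf_mem
    (s := {n | ∃ l : List V, (∀ v ∈ l, v ∈ S) ∧ (l.map refl).prod = g ∧ l.length = n})
    ⟨l.length, l, hl, hl', rfl⟩

theorem wordLength_le {S : Set V} {l : List V} (hl : ∀ v ∈ l, v ∈ S) :
    wordLength S (l.map refl).prod ≤ l.length :=
  Nat.sInf_le ⟨l, hl, rfl, rfl⟩

theorem wordLength_mul_refl_le {S : Set V} {g : V ≃ₗ[ℝ] V} (hg : g ∈ reflClosure S) {v : V}
    (hv : v ∈ S) : wordLength S (g * refl v) ≤ wordLength S g + 1 := by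
  obtain ⟨l, hl, rfl, hlen⟩ := exists_shortest_word hg
  have := wordLength_le (S := S) (l := l ++ [v])
    (by simpa [or_imp, forall_and] using ⟨hl, hv⟩)
  simpa [hlen] using this

theorem mul_refl_mem {S : Set V} {g : V ≃ₗ[ℝ] V} (hg : g ∈ reflClosure S) {v : V}
    (hv : v ∈ S) : g * refl v ∈ reflClosure S :=
  mul_mem hg (refl_mem_reflClosure hv)

theorem wordLength_le_mul_refl {S : Set V} {g : V ≃ₗ[ℝ] V} (hg : g ∈ reflClosure S) {v : V}
    (hv : v ∈ S) : wordLength S g ≤ wordLength S (g * refl v) + 1 := by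
  simpa [mul_refl_mul_refl] using wordLength_mul_refl_le (mul_refl_mem hg hv) hv

theorem exists_descent {S : Set V} {g : V ≃ₗ[ℝ] V} (hg : g ∈ reflClosure S) (h1 : g ≠ 1) :
    ∃ v ∈ S, wordLength S (g * refl v) < wordLength S g := by
  obtain ⟨l, hl, rfl, hlen⟩ := exists_shortest_word hg
  rcases List.eq_nil_or_concat l with rfl | ⟨m, v, rfl⟩
  · simp at h1
  · simp only [List.concat_eq_append, List.mem_append, List.mem_singleton, or_imp, forall_and,
      forall_eq] at hl
    refine ⟨v, hl.2, ?_⟩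
    rw [← hlen]
    have := wordLength_le (S := S) hl.1
    simp only [List.concat_eq_append, List.map_append, List.map_cons, List.map_nil,
      List.prod_append, List.prod_singleton, mul_refl_mul_refl, List.length_append,
      List.length_singleton]
    omega

/-! ### The polytope is a strict fundamental domain -/

theorem mem_poly {S : Set V} {x : V} : x ∈ poly S ↔ x ∈ hyp ∧ ∀ v ∈ S, lor v x ≤ 0 :=
  ⟨fun h => ⟨h.1, fun v hv => (h.2 v hv).2⟩, fun h => ⟨h.1, fun v hv => ⟨h.1, h.2 v hv⟩⟩⟩

/-- The half-space of `y` contains the polytope. -/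
def IsPositive (S : Set V) (y : V) : Prop := ∀ p ∈ poly S, lor y p ≤ 0

theorem IsPositive.add {S : Set V} {x y : V} (hx : IsPositive S x) (hy : IsPositive S y) :
    IsPositive S (x + y) := fun p hp => by
  rw [lor_add_left]; exact add_nonpos (hx p hp) (hy p hp)

theorem IsPositive.smul {S : Set V} {x : V} (hx : IsPositive S x) {c : ℝ} (hc : 0 ≤ c) :
    IsPositive S (c • x) := fun p hp => by
  rw [lor_smul_left]; exact mul_nonpos_of_nonneg_of_nonpos hc (hx p hp)

/-- The step of the length argument inside the infinite dihedral group of two walls that are apart.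
The condition on the coefficients `x`, `y` propagates along an alternating word in the two
reflections, and keeps the coefficients non-negative. -/
theorem isPositive_of_apart {S : Set V} (hS : IsAcute S) {n : ℕ}
    (ih : ∀ g ∈ reflClosure S, wordLength S g < n → ∀ v ∈ S,
      wordLength S g ≤ wordLength S (g * refl v) → IsPositive S (g v)) (m : ℕ) :
    m < n → ∀ g ∈ reflClosure S, wordLength S g = m → ∀ v ∈ S, ∀ w ∈ S, Apart v w →
      wordLength S g ≤ wordLength S (g * refl w) → ∀ x y : ℝ, 0 ≤ x → 0 ≤ y →
      lor v v * x ≤ -lor v w * y → IsPositive S (g (x • v + y • w)) := by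
  induction m using Nat.strong_induction_on with
  | _ m IH =>
    intro hmn g hg hgm v hv w hw hvw hgw x y hx hy hxy
    by_cases hgv : wordLength S g ≤ wordLength S (g * refl v)
    · rw [map_add, map_smul, map_smul]
      exact ((ih g hg (by omega) v hv hgv).smul hx).add ((ih g hg (by omega) w hw hgw).smul hy)
    · push Not at hgv
      have hpos := hS.pos v hv
      have key : g (x • v + y • w) = (g * refl v)
          (y • w + (-x - 2 * y * (lor v w / lor v v)) • v) := by
        rw [LinearEquiv.mul_apply, map_add (refl v), map_smul (refl v), map_smul (refl v),
          refl_self hpos.ne', refl_apply]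
        congr 1
        module
      have h2 : -(y * (lor v w / lor v v)) ≥ x := by
        rw [ge_iff_le, ← mul_div_assoc, ← neg_div, le_div_iff₀ hpos]
        linarith
      rw [key]
      refine IH _ (hgm ▸ hgv) (by omega) _ (mul_refl_mem hg hv) rfl w hw v hv hvw.symm ?_ _ _ hy
        (by linarith) ?_
      · rw [mul_refl_mul_refl]; exact hgv.le
      · have h3 : lor w w * y ≤ -lor w v * (-(y * (lor v w / lor v v))) := by
          have : -lor w v * (-(y * (lor v w / lor v v))) = lor v w ^ 2 * y / lor v v := by
            rw [lor_comm w v]; ring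
          rw [this, le_div_iff₀ hpos]
          nlinarith [hvw.2]
        have h4 : 0 < -lor w v := by rw [lor_comm]; linarith [hvw.1]
        nlinarith

/-- Tits's theorem: if the reflection along `v` does not shorten `g`, then `g` maps the root `v`
to a positive root. One strips from `g` the longest possible end in the dihedral group of `v` and
of a reflection that does shorten `g`. -/
theorem isPositive_of_wordLength_le {S : Set V} (hS : IsAcute S) (n : ℕ) :
    ∀ g ∈ reflClosure S, wordLength S g = n → ∀ v ∈ S,
      wordLength S g ≤ wordLength S (g * refl v) → IsPositive S (g v) := by
  induction n using Nat.strong_induction_on with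
  | _ n IH =>
    have ih : ∀ g ∈ reflClosure S, wordLength S g < n → ∀ v ∈ S,
        wordLength S g ≤ wordLength S (g * refl v) → IsPositive S (g v) :=
      fun g hg hn => IH _ hn g hg rfl
    intro g hg hgn v hv hgv
    by_cases h1 : g = 1
    · subst h1
      exact fun p hp => (mem_poly.1 hp).2 v hv
    obtain ⟨w, hw, hgw⟩ := exists_descent hg h1
    have hne : v ≠ w := by rintro rfl; omega
    have hpos := hS.pos w hw
    have hg₁ := mul_refl_mem hg hw
    have hg₁w : wordLength S (g * refl w) ≤ wordLength S (g * refl w * refl w) := by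
      rw [mul_refl_mul_refl]; exact hgw.le
    have hlen := wordLength_le_mul_refl hg hw
    rcases hS.pair v hv w hw hne with h | h | h
    -- The two reflections commute, and the one along `w` fixes `v`.
    · have key : g v = (g * refl w) v := by
        rw [LinearEquiv.mul_apply, refl_of_lor_eq_zero (by rw [lor_comm, h])]
      rw [key]
      refine ih _ hg₁ (hgn ▸ hgw) v hv ?_
      by_contra hlt
      push Not at hlt
      have h2 := wordLength_mul_refl_le (mul_refl_mem hg₁ hv) hw
      rw [mul_assoc g, ← refl_mul_refl_comm h, ← mul_assoc, mul_refl_mul_refl,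
        mul_assoc, refl_mul_refl_comm h, ← mul_assoc] at h2
      omega
    -- The two reflections generate a group of order six: strip one or two letters from `g`. More
    -- cannot be stripped, by the braid relation and since the reflection along `v` does not shorten
    -- `g`.
    · have key : g v = (g * refl w) (w + v) := by
        rw [LinearEquiv.mul_apply, ← h.symm.refl_apply hpos.ne', refl_refl]
      by_cases h3 : wordLength S (g * refl w) ≤ wordLength S (g * refl w * refl v)
      · rw [key, map_add]
        exact (ih _ hg₁ (hgn ▸ hgw) w hw hg₁w).add (ih _ hg₁ (hgn ▸ hgw) v hv h3)
      · push Not at h3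
        have hg₂ := mul_refl_mem hg₁ hv
        have key₂ : g v = (g * refl w * refl v) w := by
          rw [key, LinearEquiv.mul_apply _ (refl v), h.refl_apply (hS.pos v hv).ne', add_comm]
        rw [key₂]
        refine ih _ hg₂ (by omega) w hw ?_
        by_contra hlt
        push Not at hlt
        have hb : g * refl w * refl v * refl w * refl v * refl w = g * refl v := by
          have := h.braid (hS.pos v hv).ne'
          calc g * refl w * refl v * refl w * refl v * refl w
              = g * refl w * (refl v * refl w * refl v) * refl w := by simp only [mul_assoc]
            _ = g * (refl w * refl w) * refl v * (refl w * refl w) := by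
                rw [this]; simp only [mul_assoc]
            _ = g * refl v := by rw [refl_mul_self, mul_one, mul_one]
        have h4 := wordLength_mul_refl_le (mul_refl_mem hg₂ hw) hv
        have h5 := wordLength_mul_refl_le (mul_refl_mem (mul_refl_mem hg₂ hw) hv) hw
        rw [hb] at h5
        omega
    -- The two reflections generate an infinite dihedral group.
    · have key : g v = (g * refl w) ((1 : ℝ) • v + (-2 * (lor v w / lor w w)) • w) := by
        rw [LinearEquiv.mul_apply, map_add, map_smul, map_smul, refl_self hpos.ne',
          refl_apply w v, lor_comm w v]
        congr 1
        module
      rw [key]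
      refine isPositive_of_apart hS ih _ (hgn ▸ hgw) _ hg₁ rfl v hv w hw h hg₁w _ _ zero_le_one
        ?_ ?_
      · have := div_nonpos_of_nonpos_of_nonneg h.1.le hpos.le
        linarith
      · have : -lor v w * (-2 * (lor v w / lor w w)) = 2 * lor v w ^ 2 / lor w w := by ring
        rw [this, mul_one, le_div_iff₀ hpos]
        nlinarith [h.2, sq_nonneg (lor v w)]

theorem lor_map_map {S : Set V} {g : V ≃ₗ[ℝ] V} (hg : g ∈ reflClosure S) (x y : V) :
    lor (g x) (g y) = lor x y := by
  induction hg using Subgroup.closure_induction generalizing x y with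
  | mem g hg =>
    obtain ⟨v, -, rfl⟩ := hg
    exact lor_refl_refl v x y
  | one => rfl
  | mul g h _ _ hg hh => rw [LinearEquiv.mul_apply, LinearEquiv.mul_apply, hg, hh]
  | inv g _ hg =>
    rw [← hg, ← LinearEquiv.mul_apply, ← LinearEquiv.mul_apply, mul_inv_cancel]; rfl

/-- The polytope is a strict fundamental domain for the reflection group, and the stabilizer of a
point of the polytope is generated by the reflections along the walls through that point. -/
theorem mem_reflClosure_of_map_mem_poly {S : Set V} (hS : IsAcute S) {x : V} (hx : x ∈ poly S)
    (n : ℕ) : ∀ g ∈ reflClosure S, wordLength S g = n → g x ∈ poly S →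
      g ∈ reflClosure {v | v ∈ S ∧ lor v x = 0} := by
  induction n using Nat.strong_induction_on with
  | _ n IH =>
    intro g hg hgn hgx
    by_cases h1 : g = 1
    · exact h1 ▸ one_mem _
    obtain ⟨v, hv, hgv⟩ := exists_descent hg h1
    -- Since the last letter `v` shortens `g`, the root `g v` is negative, which forces `x` to lie on
    -- the wall of `v`. So this letter can be dropped.
    have hp := isPositive_of_wordLength_le hS _ _ (mul_refl_mem hg hv) rfl v hv
      (by rw [mul_refl_mul_refl]; exact hgv.le) _ hgx
    rw [LinearEquiv.mul_apply, refl_self (hS.pos v hv).ne', map_neg, lor_neg_left,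
      lor_map_map hg] at hp
    have h0 : lor v x = 0 := le_antisymm ((mem_poly.1 hx).2 v hv) (by linarith)
    have h2 := IH _ (hgn ▸ hgv) _ (mul_refl_mem hg hv) rfl
      (by rwa [LinearEquiv.mul_apply, refl_of_lor_eq_zero h0])
    have h3 := mul_mem h2 (refl_mem_reflClosure (S := {v | v ∈ S ∧ lor v x = 0}) ⟨hv, h0⟩)
    rwa [mul_refl_mul_refl] at h3

/-! ### Elliptic sets of walls -/

/-- `IsElliptic S J k n`: the set `J ⊆ S` consists of `k` vectors which are pairwise orthogonal,
except for at most one pair at angle `π / 3`. Then the reflections along `J` generate a group of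
order `n`, namely `2 ^ k`, or `6 * 2 ^ (k - 2)` if there is an exceptional pair. -/
inductive IsElliptic (S : Set V) : Set V → ℕ → ℕ → Prop
  | empty : IsElliptic S ∅ 0 1
  | pair {v w : V} : v ∈ S → w ∈ S → Third v w → IsElliptic S {v, w} 2 6
  | insert {J : Set V} {k n : ℕ} {v : V} : IsElliptic S J k n → v ∈ S → (∀ w ∈ J, lor v w = 0) →
      IsElliptic S (insert v J) (k + 1) (2 * n)

theorem IsElliptic.subset {S J : Set V} {k n : ℕ} (h : IsElliptic S J k n) : J ⊆ S := by
  induction h with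
  | empty => exact Set.empty_subset _
  | pair hv hw _ => exact Set.insert_subset hv (Set.singleton_subset_iff.2 hw)
  | insert _ hv _ ih => exact Set.insert_subset hv ih

theorem isElliptic_singleton {S : Set V} {v : V} (hv : v ∈ S) : IsElliptic S {v} 1 2 := by
  simpa using IsElliptic.empty.insert hv (by simp)

/-- The point `(1, 0, 0, 0, 0)` of hyperbolic space. -/
def basePoint : V := ![1, 0, 0, 0, 0]

theorem lor_basePoint (v : V) : lor v basePoint = -v 0 := by
  simp [lor, basePoint]

theorem basePoint_apply_zero : basePoint 0 = 1 := rfl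

/-- An elliptic set of walls is realized: projecting the base point to the orthogonal complement of
`J` only adds non-negative multiples of the vectors of `J`, hence does not leave the open
half-spaces of the other vectors of `S`. -/
theorem IsElliptic.exists_timelike {S J : Set V} {k n : ℕ} (h : IsElliptic S J k n)
    (hS : IsAcute S) : ∃ x : V, lor x x < 0 ∧ 0 < x 0 ∧ (∀ v ∈ J, lor v x = 0) ∧
      ∀ v ∈ S, v ∉ J → lor v x < 0 := by
  induction h with
  | empty =>
    refine ⟨basePoint, by simp [lor_basePoint, basePoint_apply_zero],
      by simp [basePoint_apply_zero], by simp, fun v hv _ => ?_⟩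
    rw [lor_basePoint]
    linarith [hS.time v hv]
  | @pair v w hv hw hvw =>
    have hk := hS.pos v hv
    have hv0 := hS.time v hv
    have hw0 := hS.time w hw
    obtain ⟨h1, h2⟩ := hvw
    have h3 : lor v w = -lor v v / 2 := by linarith
    -- The coefficients of the projection solve the linear system given by the Gram matrix of `v`, `w`.
    have ha : 0 < (4 * v 0 + 2 * w 0) / (3 * lor v v) := by positivity
    have hb : 0 < (2 * v 0 + 4 * w 0) / (3 * lor v v) := by positivity
    set a := (4 * v 0 + 2 * w 0) / (3 * lor v v) with ha'
    set b := (2 * v 0 + 4 * w 0) / (3 * lor v v) with hb'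
    have hvx : lor v (basePoint + a • v + b • w) = 0 := by
      rw [lor_add_right, lor_add_right, lor_smul_right, lor_smul_right, lor_basePoint, h3, ha', hb']
      field_simp
      ring
    have hwx : lor w (basePoint + a • v + b • w) = 0 := by
      rw [lor_add_right, lor_add_right, lor_smul_right, lor_smul_right, lor_basePoint,
        lor_comm w v, h3, ← h1, ha', hb']
      field_simp
      ring
    have hx0 : (basePoint + a • v + b • w) 0 = 1 + a * v 0 + b * w 0 := by
      simp [basePoint_apply_zero]
    refine ⟨basePoint + a • v + b • w, ?_, ?_, ?_, ?_⟩
    · rw [lor_add_left, lor_add_left, lor_smul_left, lor_smul_left, hvx, hwx, lor_comm,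
        lor_basePoint, hx0]
      have := mul_pos ha hv0
      have := mul_pos hb hw0
      linarith
    · rw [hx0]
      positivity
    · rintro u (rfl | rfl)
      exacts [hvx, hwx]
    · intro u hu huJ
      simp only [Set.mem_insert_iff, Set.mem_singleton_iff, not_or] at huJ
      rw [lor_add_right, lor_add_right, lor_smul_right, lor_smul_right, lor_basePoint]
      have := mul_nonpos_of_nonneg_of_nonpos ha.le (hS.lor_nonpos hu hv huJ.1)
      have := mul_nonpos_of_nonneg_of_nonpos hb.le (hS.lor_nonpos hu hw huJ.2)
      linarith [hS.time u hu]
  | @insert J k n v _ hv hvJ ih =>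
    obtain ⟨x, hx, hx0, hJ, hnJ⟩ := ih
    have hpos := hS.pos v hv
    have hvJ' : v ∉ J := fun hvm => hpos.ne' (hvJ v hvm)
    have hc : lor v x / lor v v < 0 := div_neg_of_neg_of_pos (hnJ v hv hvJ') hpos
    set c := lor v x / lor v v with hc'
    have hcv : c * lor v v = lor v x := by rw [hc']; field_simp
    have hvx : lor v (x - c • v) = 0 := by rw [lor_sub_smul, hcv, sub_self]
    refine ⟨x - c • v, ?_, ?_, ?_, ?_⟩
    · rw [lor_sub_left, lor_smul_left, hvx, lor_comm, lor_sub_left, lor_smul_left, ← hcv]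
      nlinarith [mul_pos (neg_pos.2 hc) (neg_pos.2 hc)]
    · have := mul_pos (neg_pos.2 hc) (hS.time v hv)
      simp only [Pi.sub_apply, Pi.smul_apply, smul_eq_mul]
      linarith
    · rintro u (rfl | hu)
      · exact hvx
      · rw [lor_sub_right, lor_smul_right, hJ u hu, lor_comm u v, hvJ u hu]
        simp
    · intro u hu huJ
      simp only [Set.mem_insert_iff, not_or] at huJ
      rw [lor_sub_right, lor_smul_right]
      have := mul_nonneg_of_nonpos_of_nonpos hc.le (hS.lor_nonpos hu hv huJ.1)
      linarith [hnJ u hu huJ.2]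

theorem exists_smul_mem_hyp {x : V} (hx : lor x x < 0) (hx0 : 0 < x 0) :
    ∃ c : ℝ, 0 < c ∧ c • x ∈ hyp := by
  have h : 0 < √(-lor x x) := Real.sqrt_pos.2 (by linarith)
  refine ⟨(√(-lor x x))⁻¹, inv_pos.2 h, ?_, ?_⟩
  · have h2 : √(-lor x x) * √(-lor x x) = -lor x x := Real.mul_self_sqrt (by linarith)
    rw [lor_smul_left, lor_smul_right]
    have h3 : lor x x = -(√(-lor x x) * √(-lor x x)) := by linarith
    generalize √(-lor x x) = r at *
    rw [h3]
    field_simp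
  · simp only [Pi.smul_apply, smul_eq_mul]
    positivity

/-- The stratum of the polytope where the vectors of `J` vanish. -/
def face (S J : Set V) : Set V := {x | x ∈ poly S ∧ ∀ v ∈ J, lor v x = 0}

/-- A relatively interior point of the stratum of an elliptic set. -/
theorem IsElliptic.exists_mem_face {S J : Set V} {k n : ℕ} (h : IsElliptic S J k n)
    (hS : IsAcute S) : ∃ x ∈ face S J, ∀ v ∈ S, v ∉ J → lor v x < 0 := by
  obtain ⟨x, hx, hx0, hJ, hnJ⟩ := h.exists_timelike hS
  obtain ⟨c, hc, hcx⟩ := exists_smul_mem_hyp hx hx0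
  refine ⟨c • x, ⟨mem_poly.2 ⟨hcx, fun v hv => ?_⟩, fun v hv => ?_⟩, fun v hv hvJ => ?_⟩
  · rw [lor_smul_right]
    refine mul_nonpos_of_nonneg_of_nonpos hc.le ?_
    by_cases hvJ : v ∈ J
    · exact (hJ v hvJ).le
    · exact (hnJ v hv hvJ).le
  · rw [lor_smul_right, hJ v hv, mul_zero]
  · rw [lor_smul_right]
    exact mul_neg_of_pos_of_neg hc (hnJ v hv hvJ)

/-! ### Dimension of the strata -/

/-- The linear form `⟨v, ·⟩`. -/
def lorForm (v : V) : V →ₗ[ℝ] ℝ where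
  toFun := lor v
  map_add' := lor_add_right v
  map_smul' c x := lor_smul_right c v x

/-- The orthogonal complement of a set of vectors. -/
def perp (J : Set V) : Submodule ℝ V where
  carrier := {x | ∀ v ∈ J, lor v x = 0}
  add_mem' hx hy v hv := by rw [lor_add_right, hx v hv, hy v hv, add_zero]
  zero_mem' v _ := (lorForm v).map_zero
  smul_mem' c x hx v hv := by rw [lor_smul_right, hx v hv, mul_zero]

theorem mem_perp {J : Set V} {x : V} : x ∈ perp J ↔ ∀ v ∈ J, lor v x = 0 := Iff.rfl

theorem finrank_perp_insert {J : Set V} {v x : V} (hx : x ∈ perp J) (hvx : lor v x ≠ 0) :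
    Module.finrank ℝ (perp (insert v J)) + 1 = Module.finrank ℝ (perp J) := by
  set φ : perp J →ₗ[ℝ] ℝ := (lorForm v).domRestrict (perp J) with hφ
  have hr : LinearMap.range φ = ⊤ :=
    LinearMap.range_eq_top.2 (LinearMap.surjective (f := φ) fun h0 =>
      hvx (LinearMap.congr_fun h0 ⟨x, hx⟩))
  have hk : (LinearMap.ker φ).map (perp J).subtype = perp (insert v J) := by
    ext y
    simp only [Submodule.mem_map, LinearMap.mem_ker, Submodule.subtype_apply, Subtype.exists,
      mem_perp, Set.mem_insert_iff, forall_eq_or_imp, exists_and_right, exists_eq_right]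
    exact ⟨fun ⟨h1, h2⟩ => ⟨h2, h1⟩, fun ⟨h1, h2⟩ => ⟨h2, h1⟩⟩
  rw [← hk, LinearEquiv.finrank_eq
    (Submodule.equivMapOfInjective _ (perp J).injective_subtype (LinearMap.ker φ)).symm,
    ← φ.finrank_range_add_finrank_ker, hr, finrank_top, Module.finrank_self, add_comm]

theorem IsElliptic.finrank_perp {S J : Set V} {k n : ℕ} (h : IsElliptic S J k n)
    (hS : IsAcute S) : Module.finrank ℝ (perp J) + k = 5 := by
  have h0 : Module.finrank ℝ (perp (∅ : Set V)) = 5 := by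
    have : perp (∅ : Set V) = ⊤ := by
      ext x
      simp [mem_perp]
    rw [this, finrank_top]
    simp
  induction h with
  | empty => exact h0
  | @pair v w hv hw hvw =>
    have hk := hS.pos w hw
    have h1 := finrank_perp_insert (J := ∅) (v := w) (x := w) (by simp [mem_perp]) hk.ne'
    have h2 := finrank_perp_insert (J := {w}) (v := v) (x := (2 : ℝ) • v + w) (by
      simp only [mem_perp, Set.mem_singleton_iff, forall_eq, lor_add_right, lor_smul_right]
      linarith [hvw.symm.2]) (by
      rw [lor_add_right, lor_smul_right]
      have := hvw.2
      have := hvw.1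
      intro h
      linarith)
    rw [insert_empty_eq] at h1
    omega
  | @insert J k n v _ hv hvJ ih =>
    have := finrank_perp_insert (J := J) (v := v) (x := v)
      (mem_perp.2 fun w hw => by rw [lor_comm, hvJ w hw]) (hS.pos v hv).ne'
    omega

theorem lor_continuous (v : V) : Continuous (lor v) := by
  unfold lor
  fun_prop

theorem lor_self_continuous : Continuous fun x : V => lor x x := by
  unfold lor
  fun_prop

/-- A stratum spans the orthogonal complement of `J`, since it is relatively open there at the
interior point of `IsElliptic.exists_mem_face`. -/
theorem IsElliptic.span_face {S J : Set V} {k n : ℕ} (h : IsElliptic S J k n)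
    (hS : IsAcute S) : Submodule.span ℝ (face S J) = perp J := by
  refine le_antisymm (Submodule.span_le.2 fun x hx => hx.2) fun y hy => ?_
  obtain ⟨x, hx, hneg⟩ := h.exists_mem_face hS
  have hxh := (mem_poly.1 hx.1).1
  have hcont : Continuous fun ε : ℝ => x + ε • y := by fun_prop
  have hx0 : x + (0 : ℝ) • y = x := by simp
  have e1 : ∀ᶠ ε in nhds (0 : ℝ), lor (x + ε • y) (x + ε • y) < 0 :=
    (lor_self_continuous.comp hcont).continuousAt.eventually_lt continuousAt_const
      (by simp only [Function.comp, hx0, hxh.1]; norm_num)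
  have e2 : ∀ᶠ ε in nhds (0 : ℝ), 0 < (x + ε • y) 0 :=
    continuousAt_const.eventually_lt ((continuous_apply 0).comp hcont).continuousAt
      (by simpa only [Function.comp, hx0] using hxh.2)
  have e3 : ∀ᶠ ε in nhds (0 : ℝ), ∀ v ∈ S, v ∉ J → lor v (x + ε • y) < 0 := by
    rw [Filter.eventually_all_finite hS.finite]
    intro v hv
    by_cases hvJ : v ∈ J
    · exact Filter.Eventually.of_forall fun ε hn => absurd hvJ hn
    · filter_upwards [((lor_continuous v).comp hcont).continuousAt.eventually_lt
        continuousAt_const (by simpa only [Function.comp, hx0] using hneg v hv hvJ)] with ε hε _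
      exact hε
  obtain ⟨ε, hε, h1, h2, h3⟩ :=
    ((e1.and (e2.and e3)).filter_mono nhdsWithin_le_nhds).and
      (self_mem_nhdsWithin (s := {(0 : ℝ)}ᶜ)) |>.exists.imp fun ε h =>
        (⟨h.2, h.1.1, h.1.2.1, h.1.2.2⟩ : ε ∈ ({0} : Set ℝ)ᶜ ∧ _ ∧ _ ∧ _)
  obtain ⟨c, hc, hch⟩ := exists_smul_mem_hyp h1 h2
  have hz : c • (x + ε • y) ∈ face S J := by
    have hJ : ∀ v ∈ J, lor v (x + ε • y) = 0 := fun v hv => by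
      rw [lor_add_right, lor_smul_right, hx.2 v hv, hy v hv]; simp
    refine ⟨mem_poly.2 ⟨hch, fun v hv => ?_⟩, fun v hv => by rw [lor_smul_right, hJ v hv, mul_zero]⟩
    rw [lor_smul_right]
    refine mul_nonpos_of_nonneg_of_nonpos hc.le ?_
    by_cases hvJ : v ∈ J
    · exact (hJ v hvJ).le
    · exact (h3 v hv hvJ).le
  have hε0 : ε ≠ 0 := hε
  have hy' : y = ε⁻¹ • (c⁻¹ • (c • (x + ε • y)) - x) := by
    rw [smul_smul c⁻¹, inv_mul_cancel₀ hc.ne', one_smul, add_sub_cancel_left, smul_smul,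
      inv_mul_cancel₀ hε0, one_smul]
  rw [hy']
  exact Submodule.smul_mem _ _ (Submodule.sub_mem _
    (Submodule.smul_mem _ _ (Submodule.subset_span hz)) (Submodule.subset_span hx))

theorem IsElliptic.hdim_face {S J : Set V} {k n : ℕ} (h : IsElliptic S J k n)
    (hS : IsAcute S) : hdim (face S J) = 4 - k := by
  have := h.finrank_perp hS
  rw [hdim, h.span_face hS]
  omega

/-! ### Orders of the stabilizers -/

theorem forall_mem_reflClosure_fix {J : Set V} {x : V} (hx : ∀ v ∈ J, lor v x = 0)
    {g : V ≃ₗ[ℝ] V} (hg : g ∈ reflClosure J) : g x = x := by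
  induction hg using Subgroup.closure_induction with
  | mem g hg =>
    obtain ⟨v, hv, rfl⟩ := hg
    exact refl_of_lor_eq_zero (hx v hv)
  | one => rfl
  | mul g h _ _ hg hh => rw [LinearEquiv.mul_apply, hh, hg]
  | inv g _ hg => nth_rw 1 [← hg, ← LinearEquiv.mul_apply, inv_mul_cancel]; rfl

/-- A reflection along a vector orthogonal to `J` adds a direct factor of order two. -/
theorem card_reflClosure_insert {J : Set V} {v : V} (hv : lor v v ≠ 0)
    (hJ : ∀ w ∈ J, lor v w = 0) (hfin : (reflClosure J : Set (V ≃ₗ[ℝ] V)).Finite) :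
    Nat.card (reflClosure (insert v J)) = 2 * Nat.card (reflClosure J) := by
  have hcomm : ∀ g ∈ reflClosure J, refl v * g = g * refl v := by
    intro g hg
    induction hg using Subgroup.closure_induction with
    | mem g hg =>
      obtain ⟨w, hw, rfl⟩ := hg
      exact refl_mul_refl_comm (hJ w hw)
    | one => simp
    | mul g h _ _ hg hh => rw [← mul_assoc, hg, mul_assoc, hh, mul_assoc]
    | inv g _ hg => exact (Commute.inv_right (show Commute (refl v) g from hg)).eq
  have hle : reflClosure J ≤ reflClosure (insert v J) := reflClosure_mono (Set.subset_insert v J)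
  have hset : (reflClosure (insert v J) : Set (V ≃ₗ[ℝ] V)) =
      (reflClosure J : Set (V ≃ₗ[ℝ] V)) ∪ (· * refl v) '' (reflClosure J : Set (V ≃ₗ[ℝ] V)) := by
    ext g
    constructor
    · intro hg
      induction hg using Subgroup.closure_induction_right with
      | one => exact Or.inl (one_mem _)
      | mul_right g hg x hx ih =>
        obtain ⟨w, rfl | hw, rfl⟩ := hx
        · rcases ih with ih | ⟨h, hh, rfl⟩
          · exact Or.inr ⟨g, ih, rfl⟩
          · left
            simpa only [mul_refl_mul_refl] using hh
        · rcases ih with ih | ⟨h, hh, rfl⟩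
          · exact Or.inl (mul_mem ih (refl_mem_reflClosure hw))
          · refine Or.inr ⟨h * refl w, mul_mem hh (refl_mem_reflClosure hw), ?_⟩
            simp only [mul_assoc, refl_mul_refl_comm (hJ w hw)]
      | mul_inv_cancel g hg x hx ih =>
        obtain ⟨w, rfl | hw, rfl⟩ := hx <;> rw [inv_refl]
        · rcases ih with ih | ⟨h, hh, rfl⟩
          · exact Or.inr ⟨g, ih, rfl⟩
          · left
            simpa only [mul_refl_mul_refl] using hh
        · rcases ih with ih | ⟨h, hh, rfl⟩
          · exact Or.inl (mul_mem ih (refl_mem_reflClosure hw))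
          · refine Or.inr ⟨h * refl w, mul_mem hh (refl_mem_reflClosure hw), ?_⟩
            simp only [mul_assoc, refl_mul_refl_comm (hJ w hw)]
    · rintro (hg | ⟨h, hh, rfl⟩)
      · exact hle hg
      · exact mul_mem (hle hh) (refl_mem_reflClosure (Set.mem_insert _ _))
  have hdisj : Disjoint (reflClosure J : Set (V ≃ₗ[ℝ] V))
      ((· * refl v) '' (reflClosure J : Set (V ≃ₗ[ℝ] V))) := by
    rw [Set.disjoint_left]
    rintro _ hg ⟨h, hh, rfl⟩
    -- Otherwise the reflection along `v` lies in the group of `J`, which fixes `v`.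
    have hr : refl v ∈ reflClosure J := by
      simpa using mul_mem (inv_mem hh) hg
    have h1 := forall_mem_reflClosure_fix
      (fun w hw => by rw [lor_comm, hJ w hw] : ∀ w ∈ J, lor w v = 0) hr
    rw [refl_self hv, neg_eq_iff_add_eq_zero] at h1
    have h2 : lor (v + v) v = 0 := by rw [h1]; exact (lor_comm _ _).trans (lorForm v).map_zero
    rw [lor_add_left] at h2
    exact hv (by linarith)
  have hcard : ∀ H : Subgroup (V ≃ₗ[ℝ] V), Nat.card H = (H : Set (V ≃ₗ[ℝ] V)).ncard :=
    fun H => Nat.card_coe_set_eq _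
  rw [hcard, hcard, hset, Set.ncard_union_eq hdisj hfin (hfin.image _),
    Set.ncard_image_of_injective _ (mul_left_injective (refl v)), two_mul]

/-- Two walls at angle `π / 3` generate a dihedral group of order six. -/
theorem card_reflClosure_pair {v w : V} (hv : 0 < lor v v) (h : Third v w) :
    Nat.card (reflClosure {v, w}) = 6 := by
  set a := refl v with ha
  set b := refl w with hb
  have haa : a * a = 1 := refl_mul_self v
  have hbb : b * b = 1 := refl_mul_self w
  have hbr : a * b * a = b * a * b := h.braid hv.ne'
  have hset : (reflClosure {v, w} : Set (V ≃ₗ[ℝ] V)) = {1, a, b, a * b, b * a, a * b * a} := by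
    have ham : a ∈ reflClosure {v, w} := refl_mem_reflClosure (by simp)
    have hbm : b ∈ reflClosure {v, w} := refl_mem_reflClosure (by simp)
    ext g
    constructor
    · have hstep : ∀ g ∈ ({1, a, b, a * b, b * a, a * b * a} : Set (V ≃ₗ[ℝ] V)),
          g * a ∈ ({1, a, b, a * b, b * a, a * b * a} : Set (V ≃ₗ[ℝ] V)) ∧
          g * b ∈ ({1, a, b, a * b, b * a, a * b * a} : Set (V ≃ₗ[ℝ] V)) := by
        have h1 : a * b * a * b = b * a := by rw [hbr, mul_assoc _ b b, hbb, mul_one]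
        rintro g (rfl | rfl | rfl | rfl | rfl | rfl) <;>
          simp [mul_assoc _ a a, mul_assoc _ b b, haa, hbb, ← hbr, h1]
      intro hg
      induction hg using Subgroup.closure_induction_right with
      | one => simp
      | mul_right g hg x hx ih =>
        obtain ⟨u, rfl | rfl, rfl⟩ := hx
        exacts [(hstep g ih).1, (hstep g ih).2]
      | mul_inv_cancel g hg x hx ih =>
        obtain ⟨u, rfl | rfl, rfl⟩ := hx <;> rw [inv_refl]
        exacts [(hstep g ih).1, (hstep g ih).2]
    · rintro (rfl | rfl | rfl | rfl | rfl | rfl)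
      exacts [one_mem _, ham, hbm, mul_mem ham hbm, mul_mem hbm ham,
        mul_mem (mul_mem ham hbm) ham]
  -- A linear form that separates the six images `±v`, `±w`, `±(v + w)` of `v`.
  set f : (V ≃ₗ[ℝ] V) → ℝ := fun g => 2 * lor (v + (3 : ℝ) • w) (g v) / lor v v with hf
  have hw0 : lor w w ≠ 0 := by rw [← h.1]; exact hv.ne'
  have hav : a v = -v := refl_self hv.ne'
  have haw : a w = v + w := h.refl_apply hv.ne'
  have hbv : b v = w + v := h.symm.refl_apply hw0
  have hvw : lor v w = -lor v v / 2 := by linarith [h.2]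
  have himg : f '' (reflClosure {v, w} : Set (V ≃ₗ[ℝ] V)) = ((({-1, 1, 4, 5, -4, -5} :
      Finset ℝ)) : Set ℝ) := by
    have f1 : f 1 = -1 := by
      simp only [hf, LinearEquiv.coe_one, id, lor_add_left, lor_smul_left, lor_comm w v, hvw]
      field_simp; ring
    have f2 : f a = 1 := by
      simp only [hf, hav, lor_comm _ (-v), lor_neg_left, lor_add_right, lor_smul_right, hvw]
      field_simp; ring
    have f3 : f b = 4 := by
      simp only [hf, hbv, lor_add_right, lor_add_left, lor_smul_left, lor_comm w v, hvw, ← h.1]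
      field_simp; ring
    have f4 : f (a * b) = 5 := by
      simp only [hf, LinearEquiv.mul_apply, hbv, map_add, hav, haw, add_neg_cancel_comm,
        lor_add_left, lor_smul_left, hvw, ← h.1]
      field_simp; ring
    have f5 : f (b * a) = -4 := by
      simp only [hf, LinearEquiv.mul_apply, hav, map_neg, hbv, lor_comm _ (-(w + v)), lor_neg_left,
        lor_add_left, lor_smul_right, lor_comm w v, hvw, ← h.1]
      field_simp; ring
    have f6 : f (a * b * a) = -5 := by
      simp only [hf, LinearEquiv.mul_apply, hav, map_neg, hbv, map_add, haw, add_neg_cancel_comm,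
        lor_comm _ (-w), lor_neg_left, lor_add_right, lor_smul_right, lor_comm w v, hvw, ← h.1]
      field_simp; ring
    rw [hset]
    simp only [Set.image_insert_eq, Set.image_singleton, f1, f2, f3, f4, f5, f6]
    push_cast
    rfl
  have hcard6 : (({-1, 1, 4, 5, -4, -5} : Finset ℝ)).card = 6 := by
    norm_num [Finset.card_insert_of_notMem]
  have hle : (reflClosure {v, w} : Set (V ≃ₗ[ℝ] V)).ncard ≤ 6 := by
    rw [hset]
    refine (Set.ncard_insert_le _ _).trans (Nat.succ_le_succ ?_)
    refine (Set.ncard_insert_le _ _).trans (Nat.succ_le_succ ?_)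
    refine (Set.ncard_insert_le _ _).trans (Nat.succ_le_succ ?_)
    refine (Set.ncard_insert_le _ _).trans (Nat.succ_le_succ ?_)
    refine (Set.ncard_insert_le _ _).trans (Nat.succ_le_succ ?_)
    exact (Set.ncard_singleton _).le
  have hge : 6 ≤ (reflClosure {v, w} : Set (V ≃ₗ[ℝ] V)).ncard := by
    rw [← hcard6, ← Set.ncard_coe_finset, ← himg]
    exact Set.ncard_image_le (hset ▸ Set.toFinite _)
  exact (Nat.card_coe_set_eq _).trans (le_antisymm hle hge)

theorem IsElliptic.card_reflClosure {S J : Set V} {k n : ℕ} (h : IsElliptic S J k n)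
    (hS : IsAcute S) : 0 < n ∧ Nat.card (reflClosure J) = n := by
  induction h with
  | empty => simp [reflClosure]
  | pair hv _ hvw => exact ⟨by norm_num, card_reflClosure_pair (hS.pos _ hv) hvw⟩
  | @insert J k n v _ hv hvJ ih =>
    refine ⟨by omega, ?_⟩
    rw [card_reflClosure_insert (hS.pos v hv).ne' hvJ, ih.2]
    exact Set.finite_coe_iff.1 (Nat.finite_of_card_ne_zero (ih.2.trans_ne ih.1.ne'))

theorem poly_inter_hyperplane (S : Set V) (v : V) : poly S ∩ hyperplane v = face S {v} := by
  ext x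
  simp only [face, hyperplane, Set.mem_inter_iff, Set.mem_ofPred_eq, Set.mem_singleton_iff,
    forall_eq]
  exact ⟨fun h => ⟨h.1, h.2.2⟩, fun h => ⟨h.1, (mem_poly.1 h.1).1, h.2⟩⟩

theorem wallVectors_eq {S : Set V} (hS : IsAcute S) : wallVectors S = S := by
  refine Set.Subset.antisymm (fun v hv => hv.1) fun v hv => ⟨hv, ?_, ?_⟩
  · obtain ⟨x, hx, -⟩ := (isElliptic_singleton hv).exists_mem_face hS
    exact ⟨x, poly_inter_hyperplane S v ▸ hx⟩
  · rw [poly_inter_hyperplane, (isElliptic_singleton hv).hdim_face hS]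

theorem reflGroup_eq {S : Set V} (hS : IsAcute S) : reflGroup S = reflClosure S := by
  rw [reflGroup, wallVectors_eq hS, reflClosure]

/-- The stabilizer of a stratum is generated by the reflections in the walls through it: an element
that preserves the stratum maps an interior point into the polytope. -/
theorem IsElliptic.card_stab {S J : Set V} {k n : ℕ} (h : IsElliptic S J k n)
    (hS : IsAcute S) : Nat.card (stab S (face S J)) = n := by
  have hmap : (stab S (face S J)).map (reflGroup S).subtype = reflClosure J := by
    ext g
    simp only [Subgroup.mem_map, Subgroup.subtype_apply, Subtype.exists, exists_and_right,
      exists_eq_right]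
    constructor
    · rintro ⟨hg, hst⟩
      obtain ⟨x, hx, hneg⟩ := h.exists_mem_face hS
      have hgx : g x ∈ face S J := by
        have h1 : (⟨g, hg⟩ : reflGroup S) • face S J = face S J := hst
        rw [← h1]
        exact Set.smul_mem_smul_set (a := (⟨g, hg⟩ : reflGroup S)) hx
      refine reflClosure_mono ?_ (mem_reflClosure_of_map_mem_poly hS hx.1 _ g
        (reflGroup_eq hS ▸ hg) rfl hgx.1)
      rintro v ⟨hv, hv0⟩
      by_contra hvJ
      exact (hneg v hv hvJ).ne hv0
    · intro hg
      have hgS : g ∈ reflGroup S := by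
        rw [reflGroup_eq hS]
        exact reflClosure_mono h.subset hg
      refine ⟨hgS, ?_⟩
      have hfix : ∀ x ∈ face S J, g x = x := fun x hx => forall_mem_reflClosure_fix hx.2 hg
      show (⟨g, hgS⟩ : reflGroup S) • face S J = face S J
      calc (⟨g, hgS⟩ : reflGroup S) • face S J = g '' face S J := rfl
        _ = id '' face S J := Set.image_congr hfix
        _ = face S J := Set.image_id _
  rw [← (h.card_reflClosure hS).2, ← hmap]
  exact Nat.card_congr
    (Subgroup.equivMapOfInjective _ _ (reflGroup S).subtype_injective).toEquiv

/-! ### The strata -/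

theorem strata_eq (S : Set V) : strata S = {s | s.Nonempty ∧ ∃ I ⊆ S, s = face S I} := by
  ext s
  have key : ∀ I : Set V, {x | x ∈ poly S ∧ ∀ v ∈ I, x ∈ hyperplane v} = face S I := fun I => by
    ext x
    exact ⟨fun h => ⟨h.1, fun v hv => (h.2 v hv).2⟩,
      fun h => ⟨h.1, fun v hv => ⟨(mem_poly.1 h.1).1, h.2 v hv⟩⟩⟩
  simp only [strata, key]

/-- The face of an elliptic set determines it. -/
theorem IsElliptic.subset_of_face_eq {S J K : Set V} {k n : ℕ} (hJ : IsElliptic S J k n)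
    (hS : IsAcute S) (hK : K ⊆ S) (h : face S J = face S K) : K ⊆ J := by
  obtain ⟨x, hx, hneg⟩ := hJ.exists_mem_face hS
  intro v hv
  by_contra hvJ
  exact (hneg v (hK hv) hvJ).ne ((h ▸ hx : x ∈ face S K).2 v hv)

/-- The Lorentzian product is positive definite on the orthogonal complement of a point of
hyperbolic space. It suffices for the applications to conclude `y 0 = 0`. -/
theorem eq_zero_of_lor_self_nonpos {x y : V} (hx : x ∈ hyp) (hxy : lor y x = 0)
    (hy : lor y y ≤ 0) : y 0 = 0 := by
  obtain ⟨h1, h2⟩ := hx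
  simp only [lor] at *
  -- The Cauchy–Schwarz inequality for the spatial parts.
  have cs : (x 1 * y 1 + x 2 * y 2 + x 3 * y 3 + x 4 * y 4) ^ 2 ≤
      (x 1 ^ 2 + x 2 ^ 2 + x 3 ^ 2 + x 4 ^ 2) * (y 1 ^ 2 + y 2 ^ 2 + y 3 ^ 2 + y 4 ^ 2) := by
    have := Finset.sum_mul_sq_le_sq_mul_sq Finset.univ
      ![x 1, x 2, x 3, x 4] ![y 1, y 2, y 3, y 4]
    simpa [Fin.sum_univ_four] using this
  have e1 : x 1 * y 1 + x 2 * y 2 + x 3 * y 3 + x 4 * y 4 = x 0 * y 0 := by linarith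
  have e2 : x 1 ^ 2 + x 2 ^ 2 + x 3 ^ 2 + x 4 ^ 2 = x 0 ^ 2 - 1 := by linarith
  have e3 : y 1 ^ 2 + y 2 ^ 2 + y 3 ^ 2 + y 4 ^ 2 ≤ y 0 ^ 2 := by linarith
  have e4 : 0 ≤ x 0 ^ 2 - 1 := by rw [← e2]; positivity
  rw [e1, e2] at cs
  have e5 := cs.trans (mul_le_mul_of_nonneg_left e3 e4)
  have e6 : y 0 ^ 2 ≤ 0 := by linarith [e5, mul_pow (x 0) (y 0) 2]
  exact pow_eq_zero_iff two_ne_zero |>.1 (le_antisymm e6 (sq_nonneg _))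

/-- Hyperplanes of vectors that are apart have no common point. -/
theorem not_apart_of_lor_eq_zero {v w x : V} (hv : 0 < lor v v) (hv0 : 0 < v 0) (hw0 : 0 < w 0)
    (hx : x ∈ hyp) (hvx : lor v x = 0) (hwx : lor w x = 0) : ¬Apart v w := by
  rintro ⟨h1, h2⟩
  -- The component of `w` orthogonal to `v`, up to scaling, is not space-like.
  have h3 := eq_zero_of_lor_self_nonpos (y := lor v v • w + (-lor v w) • v) hx
    (by rw [lor_add_left, lor_smul_left, lor_smul_left, hvx, hwx]; simp)
    (by
      simp only [lor_add_left, lor_smul_left, lor_add_right, lor_smul_right, lor_comm w v]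
      nlinarith)
  have h4 : 0 < (lor v v • w + (-lor v w) • v) 0 := by
    have := mul_pos hv hw0
    have := mul_pos (neg_pos.2 h1) hv0
    simp only [Pi.add_apply, Pi.smul_apply, smul_eq_mul]
    linarith
  exact h4.ne' h3

/-- Three hyperplanes that pairwise meet at the angle `π / 3` have no common point: the sum of
their vectors is light-like. -/
theorem not_third_triangle {u v w x : V} (hu0 : 0 < u 0) (hv0 : 0 < v 0) (hw0 : 0 < w 0)
    (hx : x ∈ hyp) (hux : lor u x = 0) (hvx : lor v x = 0) (hwx : lor w x = 0)
    (huv : Third u v) (huw : Third u w) (hvw : Third v w) : False := by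
  have h3 := eq_zero_of_lor_self_nonpos (y := u + v + w) hx
    (by rw [lor_add_left, lor_add_left, hux, hvx, hwx]; simp)
    (by
      simp only [lor_add_left, lor_add_right, lor_comm v u, lor_comm w u, lor_comm w v]
      linarith [huv.1, huv.2, huw.1, huw.2, hvw.1, hvw.2])
  simp only [Pi.add_apply] at h3
  linarith

theorem isPolytope_of_isAcute {S : Set V} (hS : IsAcute S) : IsPolytope S := by
  refine ⟨hS.finite, hS.pos, ?_⟩
  have hb : basePoint ∈ hyp := ⟨by rw [lor_basePoint]; rfl, one_pos⟩
  refine ⟨⟨basePoint, hb⟩, mem_interior_iff_mem_nhds.2 ?_⟩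
  have : ∀ᶠ x : hyp in nhds ⟨basePoint, hb⟩, ∀ v ∈ S, lor v x < 0 := by
    rw [Filter.eventually_all_finite hS.finite]
    intro v hv
    refine ((lor_continuous v).comp continuous_subtype_val).continuousAt.eventually_lt
      continuousAt_const ?_
    simp only [Function.comp, lor_basePoint]
    linarith [hS.time v hv]
  filter_upwards [this] with x hx
  exact mem_poly.2 ⟨x.2, fun v hv => (hx v hv).le⟩

theorem isCoxeterPolytope_of_isAcute {S : Set V} (hS : IsAcute S) : IsCoxeterPolytope S := by
  refine ⟨isPolytope_of_isAcute hS, ?_⟩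
  rw [wallVectors_eq hS]
  intro v hv w hw ⟨x, ⟨hx, hxv⟩, hxw⟩ hd
  have hpos := hS.pos v hv
  by_cases hvw : v = w
  · subst hvw
    rw [Set.inter_assoc, Set.inter_self, poly_inter_hyperplane,
      (isElliptic_singleton hv).hdim_face hS] at hd
    omega
  rcases hS.pair v hv w hw hvw with h | h | h
  · exact ⟨2, le_rfl, by simp [dihedralAngle, h]⟩
  · refine ⟨3, by norm_num, ?_⟩
    have h1 : -lor v w / √(lor v v * lor w w) = 1 / 2 := by
      rw [← h.1, Real.sqrt_mul_self hpos.le, div_eq_div_iff hpos.ne' two_ne_zero]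
      linarith [h.2]
    rw [dihedralAngle, h1, ← Real.cos_pi_div_three,
      Real.arccos_cos (by positivity) (by linarith [Real.pi_pos])]
    norm_num
  · exact absurd h (not_apart_of_lor_eq_zero hpos (hS.time v hv) (hS.time w hw)
      (mem_poly.1 hx).1 hxv.2 hxw.2)

/-! ### Integral coordinates and enumeration of the elliptic sets -/

/-- Integral data for a vector that bounds `P_t`: the vector is `c • (√2 m, a₁, a₂, a₃, a₄ / t)`,
where `c` is `√2 / n` or `1 / n`, according to whether `irr` is true or false. -/
structure Wall where
  irr : Bool
  n : ℕ
  m : ℤ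
  a₁ : ℤ
  a₂ : ℤ
  a₃ : ℤ
  a₄ : ℤ
  deriving DecidableEq

namespace Wall

/-- The scaling factor of the vector. -/
noncomputable def scale (u : Wall) : ℝ := (if u.irr then √2 else 1) / u.n

/-- The vector described by `u`. -/
noncomputable def vec (t : ℝ) (u : Wall) : V :=
  u.scale • ![√2 * u.m, u.a₁, u.a₂, u.a₃, u.a₄ / t]

/-- The Lorentzian product in integral coordinates, up to positive factors, if `t² = D / N`. -/
def form (N D : ℤ) (u w : Wall) : ℤ :=
  D * (-2 * (u.m * w.m) + u.a₁ * w.a₁ + u.a₂ * w.a₂ + u.a₃ * w.a₃) + N * (u.a₄ * w.a₄)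

/-- Orthogonality of the vectors. -/
def orth (N D : ℤ) (u w : Wall) : Bool := form N D u w == 0

/-- The relation `Third`, for vectors with the same scaling factor. -/
def third (N D : ℤ) (u w : Wall) : Bool :=
  u.irr == w.irr && u.n == w.n && form N D u u == form N D w w &&
    2 * form N D u w == -form N D u u

/-- The relation `Apart`. -/
def apart (N D : ℤ) (u w : Wall) : Bool :=
  decide (form N D u w < 0) && decide (form N D u u * form N D w w ≤ form N D u w ^ 2)

/-- The vector `u` neither is apart from a vector of the list, nor forms a triangle of three
angles `π / 3` with two of them. -/
def compatible (N D : ℤ) (u : Wall) (s : List Wall) : Bool :=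
  (s.all fun v => !apart N D u v) &&
    s.all fun v => s.all fun w => !(third N D u v && third N D u w && third N D v w)

/-- The sublists in which each vector is compatible with the vectors after it. -/
def cliques (N D : ℤ) : List Wall → List (List Wall)
  | [] => [[]]
  | u :: L => (cliques N D L).flatMap fun s => if compatible N D u s then [s, u :: s] else [s]

/-- The vectors of the list are pairwise orthogonal, except for at most one pair at angle
`π / 3`. -/
def ellipticList (N D : ℤ) : List Wall → Bool
  | [] => true
  | u :: s =>
    if s.any (third N D u) then
      (s.filter (third N D u)).length == 1 && (s.all fun v => third N D u v || orth N D u v) &&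
        decide (s.Pairwise fun v w => orth N D v w)
    else s.all (orth N D u) && ellipticList N D s

/-- The order of the group generated by the reflections along an elliptic list of vectors. In the
second case the first vector belongs to the exceptional pair, and the subtraction is exact. -/
def groupOrder (N D : ℤ) : List Wall → ℕ
  | [] => 1
  | u :: s => if s.any (third N D u) then 2 ^ (s.length - 1) * 6 else 2 * groupOrder N D s

/-- The wall `i⁺` with signs `s`. -/
def positive (s : ℤ × ℤ × ℤ) : Wall := ⟨false, 1, 1, s.1, s.2.1, s.2.2, s.1 * s.2.1 * s.2.2⟩

/-- The wall `i⁻` with signs `s`, if `t² = D / N`; here `-abc t` is written as `-abc D / (N t)`. -/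
def negative (N D : ℕ) (s : ℤ × ℤ × ℤ) : Wall :=
  ⟨false, N, N, N * s.1, N * s.2.1, N * s.2.2, -D * (s.1 * s.2.1 * s.2.2)⟩

/-- The triples of signs, in the order of `posVec` and `negVec`. -/
def signs : List (ℤ × ℤ × ℤ) :=
  [(1, 1, 1), (1, -1, 1), (1, -1, -1), (1, 1, -1), (-1, 1, -1), (-1, 1, 1), (-1, -1, 1),
    (-1, -1, -1)]

/-- The walls `A, …, F`. -/
def letters : List Wall :=
  [⟨true, 2, 1, 2, 0, 0, 0⟩, ⟨true, 2, 1, 0, 2, 0, 0⟩, ⟨true, 2, 1, 0, 0, 2, 0⟩,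
    ⟨true, 2, 1, 0, 0, -2, 0⟩, ⟨true, 2, 1, 0, -2, 0, 0⟩, ⟨true, 2, 1, -2, 0, 0, 0⟩]

/-- The walls `G` and `H`, if `t² = 3 / 5`. -/
def extras : List Wall := [⟨true, 10, 5, 0, 0, 0, -6⟩, ⟨true, 10, 5, 0, 0, 0, 6⟩]

/-- The walls other than `G` and `H`, if `t² = D / N`. -/
def mainWalls (N D : ℕ) : List Wall :=
  signs.map positive ++ signs.map (negative N D) ++ letters

/-- The walls of `P_t` for `t² = 3 / 5`. -/
def walls₁ : List Wall := mainWalls 5 3 ++ extras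

/-- The walls of `P_t` for `t² = 1 / 3`. -/
def walls₂ : List Wall := mainWalls 3 1

theorem cliques_sublist (N D : ℤ) (L : List Wall) : (cliques N D L).Sublist L.sublists := by
  induction L with
  | nil => simp [cliques]
  | cons u L ih =>
    rw [List.sublists_cons]
    refine (ih.flatMap _).trans (List.Sublist.flatMap_right _ fun s _ => ?_)
    split_ifs <;> simp

theorem sublist_of_mem_cliques {N D : ℤ} {L l : List Wall} (h : l ∈ cliques N D L) :
    l.Sublist L :=
  List.mem_sublists.1 ((cliques_sublist N D L).subset h)

theorem nodup_cliques {N D : ℤ} {L : List Wall} (h : L.Nodup) : (cliques N D L).Nodup :=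
  (cliques_sublist N D L).nodup (List.nodup_sublists.2 h)

theorem mem_cliques_of_sublist {N D : ℤ} {L l : List Wall} (h : l.Sublist L)
    (h₂ : ∀ u ∈ l, ∀ v ∈ l, apart N D u v = false)
    (h₃ : ∀ u ∈ l, ∀ v ∈ l, ∀ w ∈ l,
      (third N D u v && third N D u w && third N D v w) = false) :
    l ∈ cliques N D L := by
  induction h with
  | slnil => simp [cliques]
  | cons u _ ih =>
    refine List.mem_flatMap.2 ⟨_, ih h₂ h₃, ?_⟩
    split_ifs <;> simp
  | @cons_cons l L u _ ih =>
    have hc : compatible N D u l = true := by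
      rw [compatible, Bool.and_eq_true, List.all_eq_true, List.all_eq_true]
      refine ⟨fun v hv => ?_, fun v hv => List.all_eq_true.2 fun w hw => ?_⟩
      · rw [h₂ u (by simp) v (by simp [hv])]; rfl
      · rw [h₃ u (by simp) v (by simp [hv]) w (by simp [hw])]; rfl
    refine List.mem_flatMap.2 ⟨l, ih (fun u hu v hv => h₂ u (by simp [hu]) v (by simp [hv]))
      (fun u hu v hv w hw => h₃ u (by simp [hu]) v (by simp [hv]) w (by simp [hw])), ?_⟩
    rw [if_pos hc]
    simp

theorem filter_mem_eq_of_sublist {l L : List Wall} (h : l.Sublist L) (hL : L.Nodup) :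
    L.filter (fun u => decide (u ∈ l)) = l := by
  induction h with
  | slnil => rfl
  | @cons l L u h ih =>
    rw [List.nodup_cons] at hL
    rw [List.filter_cons_of_neg (by simpa using fun hu => hL.1 (h.subset hu)), ih hL.2]
  | @cons_cons l L u h ih =>
    rw [List.nodup_cons] at hL
    rw [List.filter_cons_of_pos (by simp)]
    refine congrArg (u :: ·) (Eq.trans (List.filter_congr fun v hv => ?_) (ih hL.2))
    have : v ≠ u := by rintro rfl; exact hL.1 hv
    simp [this]

/-! ### Polytopes with integral coordinates -/

/-- The vectors described by a list of walls. -/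
def vecSet (t : ℝ) (l : List Wall) : Set V := {v | ∃ u ∈ l, vec t u = v}

theorem vecSet_nil (t : ℝ) : vecSet t [] = ∅ := by simp [vecSet]

theorem vecSet_cons (t : ℝ) (u : Wall) (l : List Wall) :
    vecSet t (u :: l) = insert (vec t u) (vecSet t l) := by
  ext v
  simp [vecSet, eq_comm]

theorem vecSet_mono (t : ℝ) {l m : List Wall} (h : ∀ u ∈ l, u ∈ m) : vecSet t l ⊆ vecSet t m :=
  fun _ ⟨u, hu, hv⟩ => ⟨u, h u hu, hv⟩

/-- The conditions under which the list `L` describes, for `t² = D / N`, an acute set of vectors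
whose elliptic subsets are those given by `cliques N D L`. -/
structure IsDiagram (t : ℝ) (N D : ℤ) (L : List Wall) : Prop where
  t_pos : 0 < t
  sq : (N : ℝ) * t ^ 2 = D
  D_pos : 0 < D
  valid : ∀ u ∈ L, 0 < u.n ∧ 0 < u.m ∧ 0 < form N D u u
  pair : L.Pairwise fun u w => orth N D u w ∨ third N D u w ∨ apart N D u w
  elliptic : ∀ l ∈ cliques N D L, ellipticList N D l

variable {t : ℝ} {N D : ℤ} {L : List Wall}

theorem lor_vec (ht : 0 < t) (hsq : (N : ℝ) * t ^ 2 = D) (hD : 0 < D) (u w : Wall) :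
    lor (vec t u) (vec t w) = u.scale * w.scale / D * form N D u w := by
  have hD' : (D : ℝ) ≠ 0 := by exact_mod_cast hD.ne'
  have h2 : √2 * √2 = 2 := Real.mul_self_sqrt zero_le_two
  have key : (D : ℝ) * lor ![√2 * u.m, u.a₁, u.a₂, u.a₃, u.a₄ / t]
      ![√2 * w.m, w.a₁, w.a₂, w.a₃, w.a₄ / t] = form N D u w := by
    simp only [lor, form, Matrix.cons_val]
    push_cast
    have h3 : (D : ℝ) * (u.a₄ / t * (w.a₄ / t)) = N * (u.a₄ * w.a₄) := by
      rw [← hsq]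
      field_simp
    linear_combination h3 - D * u.m * w.m * h2
  rw [vec, vec, lor_smul_left, lor_smul_right, ← key]
  field_simp

theorem scale_pos {u : Wall} (hu : 0 < u.n) : 0 < u.scale := by
  have : (0 : ℝ) < u.n := by exact_mod_cast hu
  unfold scale
  split_ifs <;> positivity

theorem lor_vec_eq_zero (ht : 0 < t) (hsq : (N : ℝ) * t ^ 2 = D) (hD : 0 < D) {u w : Wall}
    (h : orth N D u w) : lor (vec t u) (vec t w) = 0 := by
  rw [orth, beq_iff_eq] at h
  rw [lor_vec ht hsq hD, h, Int.cast_zero, mul_zero]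

theorem third_vec (ht : 0 < t) (hsq : (N : ℝ) * t ^ 2 = D) (hD : 0 < D) {u w : Wall}
    (h : third N D u w) : Third (vec t u) (vec t w) := by
  simp only [third, Bool.and_eq_true, beq_iff_eq] at h
  obtain ⟨⟨⟨h1, h2⟩, h3⟩, h4⟩ := h
  have hs : u.scale = w.scale := by rw [scale, scale, h1, h2]
  have h5 : 2 * (form N D u w : ℝ) = -form N D u u := by exact_mod_cast h4
  refine ⟨by rw [lor_vec ht hsq hD, lor_vec ht hsq hD, hs, h3], ?_⟩
  rw [lor_vec ht hsq hD, lor_vec ht hsq hD, hs]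
  linear_combination w.scale * w.scale / D * h5

theorem apart_vec (ht : 0 < t) (hsq : (N : ℝ) * t ^ 2 = D) (hD : 0 < D) {u w : Wall}
    (hu : 0 < u.n) (hw : 0 < w.n) (h : apart N D u w) : Apart (vec t u) (vec t w) := by
  simp only [apart, Bool.and_eq_true, decide_eq_true_eq] at h
  obtain ⟨h1, h2⟩ := h
  have hD' : (0 : ℝ) < D := by exact_mod_cast hD
  have h3 : (form N D u w : ℝ) < 0 := by exact_mod_cast h1
  have h4 : (form N D u u * form N D w w : ℝ) ≤ form N D u w ^ 2 := by exact_mod_cast h2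
  have hp := scale_pos hu
  have hq := scale_pos hw
  refine ⟨?_, ?_⟩
  · rw [lor_vec ht hsq hD]
    exact mul_neg_of_pos_of_neg (by positivity) h3
  · rw [lor_vec ht hsq hD, lor_vec ht hsq hD, lor_vec ht hsq hD]
    calc _ = (u.scale * w.scale / D) ^ 2 * (form N D u u * form N D w w : ℝ) := by ring
      _ ≤ (u.scale * w.scale / D) ^ 2 * form N D u w ^ 2 := by gcongr
      _ = _ := by ring

theorem IsDiagram.lor_vec_pos (h : IsDiagram t N D L) {u : Wall} (hu : u ∈ L) :
    0 < lor (vec t u) (vec t u) := by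
  have hD : (0 : ℝ) < D := by exact_mod_cast h.D_pos
  have h1 : (0 : ℝ) < form N D u u := by exact_mod_cast (h.valid u hu).2.2
  have := scale_pos (h.valid u hu).1
  rw [lor_vec h.t_pos h.sq h.D_pos]
  positivity

theorem IsDiagram.vec_zero_pos (h : IsDiagram t N D L) {u : Wall} (hu : u ∈ L) :
    0 < vec t u 0 := by
  have h1 : (0 : ℝ) < u.m := by exact_mod_cast (h.valid u hu).2.1
  have := scale_pos (h.valid u hu).1
  simp only [vec, Pi.smul_apply, Matrix.cons_val_zero, smul_eq_mul]
  positivity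

theorem IsDiagram.pair_vec (h : IsDiagram t N D L) :
    L.Pairwise fun u w => lor (vec t u) (vec t w) = 0 ∨ Third (vec t u) (vec t w) ∨
      Apart (vec t u) (vec t w) := by
  refine h.pair.imp_of_mem fun {u w} hu hw huw => ?_
  rcases huw with huw | huw | huw
  · exact Or.inl (lor_vec_eq_zero h.t_pos h.sq h.D_pos huw)
  · exact Or.inr (Or.inl (third_vec h.t_pos h.sq h.D_pos huw))
  · exact Or.inr (Or.inr (apart_vec h.t_pos h.sq h.D_pos (h.valid u hu).1 (h.valid w hw).1 huw))

theorem IsDiagram.nodup_map (h : IsDiagram t N D L) : (L.map (vec t)).Nodup := by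
  refine List.pairwise_map.2 (h.pair_vec.imp_of_mem fun {u w} hu _ huw heq => ?_)
  rw [← heq] at huw
  have := h.lor_vec_pos hu
  rcases huw with huw | huw | huw
  · exact this.ne' huw
  · linarith [huw.2]
  · exact this.not_gt huw.1

theorem IsDiagram.isAcute (h : IsDiagram t N D L) : IsAcute (vecSet t L) where
  finite := (L.finite_toSet.image (vec t)).subset fun _ ⟨u, hu, hv⟩ => ⟨u, hu, hv⟩
  pos := by
    rintro _ ⟨u, hu, rfl⟩
    exact h.lor_vec_pos hu
  time := by
    rintro _ ⟨u, hu, rfl⟩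
    exact h.vec_zero_pos hu
  pair := by
    rintro _ ⟨u, hu, rfl⟩ _ ⟨w, hw, rfl⟩ hne
    revert hne
    exact List.Pairwise.forall_of_forall_of_flip (R := fun u w => vec t u ≠ vec t w →
        lor (vec t u) (vec t w) = 0 ∨ Third (vec t u) (vec t w) ∨ Apart (vec t u) (vec t w))
      (fun u _ hne => absurd rfl hne)
      (h.pair_vec.imp fun {u w} huw (_ : vec t u ≠ vec t w) => huw)
      (h.pair_vec.imp fun {u w} huw (_ : vec t w ≠ vec t u) =>
        huw.imp (fun h0 => by rw [lor_comm, h0]) (Or.imp Third.symm Apart.symm)) hu hw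

/-- Adjoining pairwise orthogonal vectors to an elliptic set that is orthogonal to them. -/
theorem isElliptic_union (h : IsDiagram t N D L) {J : Set V} {k n : ℕ}
    (hJ : IsElliptic (vecSet t L) J k n) {s : List Wall} (hs : ∀ u ∈ s, u ∈ L)
    (hsJ : ∀ u ∈ s, ∀ w ∈ J, lor (vec t u) w = 0) (hss : s.Pairwise fun v w => orth N D v w) :
    IsElliptic (vecSet t L) (vecSet t s ∪ J) (k + s.length) (2 ^ s.length * n) := by
  induction s with
  | nil => simpa [vecSet_nil] using hJ
  | cons u s ih =>
    rw [List.pairwise_cons] at hss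
    have := (ih (fun v hv => hs v (by simp [hv])) (fun v hv => hsJ v (by simp [hv]))
      hss.2).insert (v := vec t u) ⟨u, hs u (by simp), rfl⟩ (by
        rintro w (⟨v, hv, rfl⟩ | hw)
        · exact lor_vec_eq_zero h.t_pos h.sq h.D_pos (hss.1 v hv)
        · exact hsJ u (by simp) w hw)
    rw [vecSet_cons, Set.insert_union, List.length_cons, ← add_assoc, pow_succ', mul_assoc]
    exact this

theorem isElliptic_of_ellipticList (h : IsDiagram t N D L) {l : List Wall} (hl : ∀ u ∈ l, u ∈ L)
    (hell : ellipticList N D l) :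
    IsElliptic (vecSet t L) (vecSet t l) l.length (groupOrder N D l) := by
  induction l with
  | nil => exact vecSet_nil t ▸ .empty
  | cons u s ih =>
    have hu : vec t u ∈ vecSet t L := ⟨u, hl u (by simp), rfl⟩
    have hs : ∀ v ∈ s, v ∈ L := fun v hv => hl v (by simp [hv])
    rw [ellipticList] at hell
    rw [groupOrder]
    split_ifs at hell ⊢ with hany
    · simp only [Bool.and_eq_true, beq_iff_eq, decide_eq_true_eq, List.all_eq_true,
        Bool.or_eq_true] at hell
      obtain ⟨⟨h1, h2⟩, h3⟩ := hell
      obtain ⟨b, hb⟩ := List.length_eq_one_iff.1 h1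
      have hperm := List.filter_append_perm (third N D u) s
      rw [hb, List.singleton_append] at hperm
      set r := s.filter fun v => !third N D u v with hr
      have hbs : b ∈ s.filter (third N D u) := hb ▸ List.mem_singleton_self b
      rw [List.mem_filter] at hbs
      have hrs : ∀ v ∈ r, v ∈ s ∧ third N D u v = false := fun v hv => by
        simpa [hr] using hv
      have horth : (b :: r).Pairwise fun v w => orth N D v w :=
        (hperm.pairwise_iff (R := fun v w => (orth N D v w : Prop)) fun {v w} hvw => by
          simp only [orth, form, beq_iff_eq] at hvw ⊢
          linarith).2 h3
      rw [List.pairwise_cons] at horth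
      have := isElliptic_union h (.pair hu ⟨b, hs b hbs.1, rfl⟩
        (third_vec h.t_pos h.sq h.D_pos hbs.2)) (s := r) (fun v hv => hs v (hrs v hv).1) (by
          rintro v hv w (rfl | rfl)
          · rw [lor_comm]
            refine lor_vec_eq_zero h.t_pos h.sq h.D_pos ((h2 v (hrs v hv).1).resolve_left ?_)
            simp [(hrs v hv).2]
          · rw [lor_comm]
            exact lor_vec_eq_zero h.t_pos h.sq h.D_pos (horth.1 v hv)) horth.2
      have hlen : s.length = r.length + 1 := by rw [← hperm.length_eq, List.length_cons]
      have hset : vecSet t (u :: s) = vecSet t r ∪ {vec t u, vec t b} := by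
        have : vecSet t s = vecSet t (b :: r) :=
          Set.Subset.antisymm (vecSet_mono t fun v hv => hperm.symm.subset hv)
            (vecSet_mono t fun v hv => hperm.subset hv)
        rw [vecSet_cons, this, vecSet_cons, Set.union_comm, Set.insert_union, Set.singleton_union]
      rw [hset, List.length_cons, hlen, Nat.add_sub_cancel, add_assoc, add_comm]
      exact this
    · simp only [Bool.and_eq_true, List.all_eq_true] at hell
      rw [vecSet_cons]
      refine (ih hs hell.2).insert hu ?_
      rintro _ ⟨v, hv, rfl⟩
      exact lor_vec_eq_zero h.t_pos h.sq h.D_pos (hell.1 v hv)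

/-- The stratum that corresponds to a list of walls. -/
def stratum (t : ℝ) (L l : List Wall) : Set V := face (vecSet t L) (vecSet t l)

theorem IsDiagram.isElliptic (h : IsDiagram t N D L) {l : List Wall} (hl : l ∈ cliques N D L) :
    IsElliptic (vecSet t L) (vecSet t l) l.length (groupOrder N D l) :=
  isElliptic_of_ellipticList h (fun _ hu => (sublist_of_mem_cliques hl).subset hu)
    (h.elliptic l hl)

theorem IsDiagram.hdim_stratum (h : IsDiagram t N D L) {l : List Wall}
    (hl : l ∈ cliques N D L) : hdim (stratum t L l) = 4 - l.length :=
  (h.isElliptic hl).hdim_face h.isAcute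

theorem IsDiagram.card_stab_stratum (h : IsDiagram t N D L) {l : List Wall}
    (hl : l ∈ cliques N D L) :
    Nat.card (stab (vecSet t L) (stratum t L l)) = groupOrder N D l :=
  (h.isElliptic hl).card_stab h.isAcute

theorem IsDiagram.injOn_stratum (h : IsDiagram t N D L) :
    Set.InjOn (stratum t L) {l | l ∈ cliques N D L} := by
  have hsub : ∀ l ∈ cliques N D L, ∀ m ∈ cliques N D L, stratum t L l = stratum t L m →
      ∀ u ∈ m, u ∈ l := by
    intro l hl m hm heq u hu
    have hmL := sublist_of_mem_cliques hm
    obtain ⟨w, hw, hwu⟩ := (h.isElliptic hl).subset_of_face_eq h.isAcute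
      (vecSet_mono t fun v hv => hmL.subset hv) heq ⟨u, hu, rfl⟩
    have := List.inj_on_of_nodup_map h.nodup_map ((sublist_of_mem_cliques hl).subset hw)
      (hmL.subset hu) hwu
    exact this ▸ hw
  intro l hl m hm heq
  have hlm : ∀ u, u ∈ l ↔ u ∈ m := fun u =>
    ⟨hsub m hm l hl heq.symm u, hsub l hl m hm heq u⟩
  have hnd : L.Nodup := .of_map _ h.nodup_map
  rw [← filter_mem_eq_of_sublist (sublist_of_mem_cliques hl) hnd,
    ← filter_mem_eq_of_sublist (sublist_of_mem_cliques hm) hnd]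
  simp only [hlm]

theorem IsDiagram.strata_eq (h : IsDiagram t N D L) :
    strata (vecSet t L) = stratum t L '' {l | l ∈ cliques N D L} := by
  classical
  rw [HypFour.strata_eq]
  ext s
  constructor
  · rintro ⟨⟨x, hx⟩, I, hI, rfl⟩
    have hxh := (mem_poly.1 hx.1).1
    -- The walls in `I` themselves form an elliptic set, as they pass through the point `x`.
    set l := L.filter fun u => vec t u ∈ I with hl
    have hlI : vecSet t l = I := by
      ext v
      constructor
      · rintro ⟨u, hu, rfl⟩
        simpa using (List.mem_filter.1 hu).2
      · intro hv
        obtain ⟨u, hu, rfl⟩ := hI hv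
        exact ⟨u, List.mem_filter.2 ⟨hu, by simpa using hv⟩, rfl⟩
    have hlL : ∀ u ∈ l, u ∈ L := fun u hu => (List.mem_filter.1 hu).1
    have hx0 : ∀ u ∈ l, lor (vec t u) x = 0 := fun u hu => hx.2 _ (hlI ▸ ⟨u, hu, rfl⟩)
    refine ⟨l, mem_cliques_of_sublist List.filter_sublist (fun u hu v hv => ?_)
      (fun u hu v hv w hw => ?_), by rw [stratum, hlI]⟩
    · refine Bool.eq_false_iff.2 fun hap => ?_
      exact not_apart_of_lor_eq_zero (h.lor_vec_pos (hlL u hu)) (h.vec_zero_pos (hlL u hu))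
        (h.vec_zero_pos (hlL v hv)) hxh (hx0 u hu) (hx0 v hv)
        (apart_vec h.t_pos h.sq h.D_pos (h.valid u (hlL u hu)).1 (h.valid v (hlL v hv)).1 hap)
    · refine Bool.eq_false_iff.2 fun hth => ?_
      rw [Bool.and_eq_true, Bool.and_eq_true] at hth
      exact not_third_triangle (h.vec_zero_pos (hlL u hu)) (h.vec_zero_pos (hlL v hv))
        (h.vec_zero_pos (hlL w hw)) hxh (hx0 u hu) (hx0 v hv) (hx0 w hw)
        (third_vec h.t_pos h.sq h.D_pos hth.1.1) (third_vec h.t_pos h.sq h.D_pos hth.1.2)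
        (third_vec h.t_pos h.sq h.D_pos hth.2)
  · rintro ⟨l, hl, rfl⟩
    obtain ⟨x, hx, -⟩ := (h.isElliptic hl).exists_mem_face h.isAcute
    exact ⟨⟨x, hx⟩, _, (h.isElliptic hl).subset, rfl⟩

theorem IsDiagram.nodup (h : IsDiagram t N D L) : (cliques N D L).Nodup :=
  nodup_cliques (.of_map _ h.nodup_map)

theorem IsDiagram.stratumCount_eq (h : IsDiagram t N D L) (k n : ℕ) :
    stratumCount (vecSet t L) k n = ((cliques N D L).filter fun l =>
      4 - l.length == k && groupOrder N D l == n).length := by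
  have hset : {s | s ∈ strata (vecSet t L) ∧ hdim s = k ∧ Nat.card (stab (vecSet t L) s) = n} =
      stratum t L '' (((cliques N D L).filter fun l =>
        4 - l.length == k && groupOrder N D l == n).toFinset : Set (List Wall)) := by
    rw [h.strata_eq]
    ext s
    constructor
    · rintro ⟨⟨l, hl, rfl⟩, h1, h2⟩
      rw [h.hdim_stratum hl] at h1
      rw [h.card_stab_stratum hl] at h2
      exact ⟨l, by simpa using ⟨hl, h1, h2⟩, rfl⟩
    · rintro ⟨l, hl, rfl⟩
      simp only [List.coe_toFinset, List.mem_filter, Bool.and_eq_true, beq_iff_eq] at hl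
      obtain ⟨hl, h1, h2⟩ := hl
      exact ⟨⟨l, hl, rfl⟩, by rw [h.hdim_stratum hl, h1], by rw [h.card_stab_stratum hl, h2]⟩
  rw [stratumCount, hset, Set.InjOn.ncard_image, Set.ncard_coe_finset,
    List.toFinset_card_of_nodup (h.nodup.filter _)]
  exact h.injOn_stratum.mono fun l hl => by
    simp only [List.coe_toFinset, List.mem_filter] at hl
    exact hl.1

theorem IsDiagram.eulerChar_eq (h : IsDiagram t N D L) :
    eulerChar (vecSet t L) = ((cliques N D L).map fun l =>
      (-1 : ℚ) ^ (4 - l.length) / (groupOrder N D l : ℚ)).sum := by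
  have hset : {l | l ∈ cliques N D L} = ((cliques N D L).toFinset : Set (List Wall)) := by simp
  rw [eulerChar, h.strata_eq, finsum_mem_image h.injOn_stratum, hset, finsum_mem_coe_finset,
    List.sum_toFinset _ h.nodup]
  congr 1
  refine List.map_congr_left fun l hl => ?_
  rw [h.hdim_stratum hl, h.card_stab_stratum hl]

theorem IsDiagram.hdim_card_mem (h : IsDiagram t N D L) {T : Set (ℕ × ℕ)}
    (hT : ∀ l ∈ cliques N D L, (4 - l.length, groupOrder N D l) ∈ T) :
    ∀ s ∈ strata (vecSet t L), (hdim s, Nat.card (stab (vecSet t L) s)) ∈ T := by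
  rw [h.strata_eq]
  rintro _ ⟨l, hl, rfl⟩
  rw [h.hdim_stratum hl, h.card_stab_stratum hl]
  exact hT l hl

/-! ### The polytopes `P_t` -/

theorem range_posVec (t : ℝ) : Set.range (posVec t) = vecSet t (signs.map positive) := by
  have h : ∀ i, posVec t i = vec t ((signs.map positive).get (i.cast rfl)) := by
    intro i
    fin_cases i <;> ext j <;> fin_cases j <;> simp [posVec, vec, scale, signs, positive]
  ext v
  simp only [Set.mem_range, vecSet, Set.mem_ofPred_eq, List.mem_iff_get]
  exact ⟨fun ⟨i, hi⟩ => ⟨_, ⟨i.cast rfl, rfl⟩, (h i).symm.trans hi⟩,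
    fun ⟨_, ⟨i, hi⟩, hv⟩ => ⟨i.cast rfl, (h _).trans (hi ▸ hv)⟩⟩

theorem range_negVec {t : ℝ} {N D : ℕ} (ht : 0 < t) (hN : 0 < N) (hsq : (N : ℝ) * t ^ 2 = D) :
    Set.range (negVec t) = vecSet t (signs.map (negative N D)) := by
  have hN' : (N : ℝ) ≠ 0 := by exact_mod_cast hN.ne'
  have h : ∀ i, negVec t i = vec t ((signs.map (negative N D)).get (i.cast rfl)) := by
    intro i
    fin_cases i <;> ext j <;> fin_cases j <;>
      simp [negVec, vec, scale, signs, negative, ← hsq] <;> field_simp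
  ext v
  simp only [Set.mem_range, vecSet, Set.mem_ofPred_eq, List.mem_iff_get]
  exact ⟨fun ⟨i, hi⟩ => ⟨_, ⟨i.cast rfl, rfl⟩, (h i).symm.trans hi⟩,
    fun ⟨_, ⟨i, hi⟩, hv⟩ => ⟨i.cast rfl, (h _).trans (hi ▸ hv)⟩⟩

theorem range_letterVec (t : ℝ) : Set.range letterVec = vecSet t letters := by
  have h : ∀ i, letterVec i = vec t (letters.get (i.cast rfl)) := by
    have h2 : √2 * √2 = 2 := Real.mul_self_sqrt zero_le_two
    intro i
    fin_cases i <;> ext j <;> fin_cases j <;> simp [letterVec, vec, scale, letters] <;>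
      linarith
  ext v
  simp only [Set.mem_range, vecSet, Set.mem_ofPred_eq, List.mem_iff_get]
  exact ⟨fun ⟨i, hi⟩ => ⟨_, ⟨i.cast rfl, rfl⟩, (h i).symm.trans hi⟩,
    fun ⟨_, ⟨i, hi⟩, hv⟩ => ⟨i.cast rfl, (h _).trans (hi ▸ hv)⟩⟩

theorem range_extraVec {t : ℝ} (ht : 0 < t) (hsq : 5 * t ^ 2 = 3) :
    Set.range (extraVec t) = vecSet t extras := by
  have h : ∀ i, extraVec t i = vec t (extras.get (i.cast rfl)) := by
    have h2 : √2 * √2 = 2 := Real.mul_self_sqrt zero_le_two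
    intro i
    fin_cases i <;> ext j <;> fin_cases j <;> simp [extraVec, vec, scale, extras] <;>
      field_simp <;> linarith
  ext v
  simp only [Set.mem_range, vecSet, Set.mem_ofPred_eq, List.mem_iff_get]
  exact ⟨fun ⟨i, hi⟩ => ⟨_, ⟨i.cast rfl, rfl⟩, (h i).symm.trans hi⟩,
    fun ⟨_, ⟨i, hi⟩, hv⟩ => ⟨i.cast rfl, (h _).trans (hi ▸ hv)⟩⟩

theorem vecSet_append (t : ℝ) (l m : List Wall) :
    vecSet t (l ++ m) = vecSet t l ∪ vecSet t m := by
  ext v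
  simp [vecSet, or_and_right, exists_or]

theorem vecSet_mainWalls {t : ℝ} {N D : ℕ} (ht : 0 < t) (hN : 0 < N)
    (hsq : (N : ℝ) * t ^ 2 = D) : vecSet t (mainWalls N D) =
      Set.range (posVec t) ∪ Set.range (negVec t) ∪ Set.range letterVec := by
  rw [mainWalls, vecSet_append, vecSet_append, range_posVec, range_negVec ht hN hsq,
    range_letterVec t]

theorem P_sqrt_three_fifths : P √(3 / 5) = vecSet √(3 / 5) walls₁ := by
  have ht : 0 < √(3 / 5) := Real.sqrt_pos.2 (by norm_num)
  have hsq : √(3 / 5) ^ 2 = 3 / 5 := Real.sq_sqrt (by norm_num)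
  have hlt : √(1 / 2) < √(3 / 5) := Real.sqrt_lt_sqrt (by norm_num) (by norm_num)
  rw [walls₁, vecSet_append, vecSet_mainWalls ht (by norm_num) (by rw [hsq]; norm_num),
    ← range_extraVec ht (by rw [hsq]; norm_num), P]
  simp only [hlt, true_and]
  rfl

/-- The vectors `G` and `H` do not occur, since `√(1 / 3) ≤ √(1 / 2)`. -/
theorem P_sqrt_third : P √(1 / 3) = vecSet √(1 / 3) walls₂ := by
  have ht : 0 < √(1 / 3) := Real.sqrt_pos.2 (by norm_num)
  have hsq : √(1 / 3) ^ 2 = 1 / 3 := Real.sq_sqrt (by norm_num)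
  have hlt : ¬√(1 / 2) < √(1 / 3) := (Real.sqrt_le_sqrt (by norm_num)).not_gt
  rw [walls₂, vecSet_mainWalls ht (by norm_num) (by rw [hsq]; norm_num), P]
  simp only [hlt, false_and]
  exact Set.union_empty _

theorem isDiagram₁ : IsDiagram √(3 / 5) 5 3 walls₁ where
  t_pos := Real.sqrt_pos.2 (by norm_num)
  sq := by rw [Real.sq_sqrt (by norm_num)]; norm_num
  D_pos := by norm_num
  valid := by decide +kernel
  pair := by decide +kernel
  elliptic := by decide +kernel

theorem isDiagram₂ : IsDiagram √(1 / 3) 3 1 walls₂ where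
  t_pos := Real.sqrt_pos.2 (by norm_num)
  sq := by rw [Real.sq_sqrt (by norm_num)]; norm_num
  D_pos := by norm_num
  valid := by decide +kernel
  pair := by decide +kernel
  elliptic := by decide +kernel

end Wall

end HypFour

theorem mainTheorem10 :
    (IsCoxeterPolytope (P √(3 / 5)) ∧
      (∀ s ∈ strata (P √(3 / 5)),
        (hdim s, Nat.card (stab (P √(3 / 5)) s)) ∈
          ({(4, 1), (3, 2), (2, 4), (2, 6), (1, 8), (1, 12), (0, 24)} : Set (ℕ × ℕ))) ∧
      stratumCount (P √(3 / 5)) 4 1 = 1 ∧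
      stratumCount (P √(3 / 5)) 3 2 = 24 ∧
      stratumCount (P √(3 / 5)) 2 4 = 88 ∧
      stratumCount (P √(3 / 5)) 2 6 = 12 ∧
      stratumCount (P √(3 / 5)) 1 8 = 72 ∧
      stratumCount (P √(3 / 5)) 1 12 = 48 ∧
      stratumCount (P √(3 / 5)) 0 24 = 24 ∧
      eulerChar (P √(3 / 5)) = 1) ∧
    (IsCoxeterPolytope (P √(1 / 3)) ∧
      (∀ s ∈ strata (P √(1 / 3)),
        (hdim s, Nat.card (stab (P √(1 / 3)) s)) ∈
          ({(4, 1), (3, 2), (2, 4), (1, 8), (0, 16)} : Set (ℕ × ℕ))) ∧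
      stratumCount (P √(1 / 3)) 4 1 = 1 ∧
      stratumCount (P √(1 / 3)) 3 2 = 22 ∧
      stratumCount (P √(1 / 3)) 2 4 = 92 ∧
      stratumCount (P √(1 / 3)) 1 8 = 116 ∧
      stratumCount (P √(1 / 3)) 0 16 = 34 ∧
      eulerChar (P √(1 / 3)) = 5 / 8) := by
  rw [Wall.P_sqrt_three_fifths, Wall.P_sqrt_third]
  simp only [Wall.isDiagram₁.stratumCount_eq, Wall.isDiagram₂.stratumCount_eq,
    Wall.isDiagram₁.eulerChar_eq, Wall.isDiagram₂.eulerChar_eq]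
  refine ⟨⟨isCoxeterPolytope_of_isAcute Wall.isDiagram₁.isAcute,
      Wall.isDiagram₁.hdim_card_mem ?_, ?_⟩,
    isCoxeterPolytope_of_isAcute Wall.isDiagram₂.isAcute, Wall.isDiagram₂.hdim_card_mem ?_, ?_⟩
  -- What remains is the enumeration of the elliptic sets.
  · simp only [Set.mem_insert_iff, Set.mem_singleton_iff]
    decide +kernel
  · decide +kernel
  · simp only [Set.mem_insert_iff, Set.mem_singleton_iff]
    decide +kernel
  · decide +kernel
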